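/- **Setting.** Let $H$ be a separable complex Hilbert space, $A$ a bounded operator on $H$ with $A^*A=AA^*=r_AI$, $r_A>0$, and $\phi\in H$ a unit vector that is cyclic: the vectors $P(A,A^*)\phi$, $P\in\mathbb C[X,Y]$, are dense. For $N\in\mathbb N$ let $H_N=\mathrm{span}\{A^i(A^*)^j\phi: i,j\le N\}$, $H_N^-=\mathrm{span}\{A^i(A^*)^j\phi: i<N,\,j\le N\}$, $H_N^+=\mathrm{span}\{A^i(A^*)^j\phi: 0<i\le N,\ j\le N\}$. Fix a unitary $V_N$ from $H_N\ominus H_N^-$ onto $H_N\ominus H_N^+$ and let $A_N$ be the operator on $H_N$ that equals $A$ on $H_N^-$ and $\sqrt{r_A}\,V_N$ on $H_N\ominus H_N^-$. Fix an orthonormal basis $u_N(k)$, $k<D_N=\dim H_N$, of $H_N$ with $A_Nu_N(k)=\lambda_N(k)u_N(k)$ and $\xi_N(k):=\langle u_N(k)|\phi\rangle\ge 0$ (inner products are antilinear in the first variable). Fix a natural number $M>\|A\|,\sqrt{r_A}$, put $S=\{\lambda: |\mathrm{Re}\,\lambda|,|\mathrm{Im}\,\lambda|\le M\}$, and fix an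 ultrafilter $D$ on $\mathbb N$ that contains $\{N>0:\sqrt N\in\mathbb N,\ m\mid\sqrt N\}$ for all $m>0$. **Spectral measure.** Let $\mu_N(X)=\sum_{\lambda_N(k)\in X}\xi_N(k)^2$ and $\mu^n(X)=\lim_D\mu_N(X)$. For $r\in[-M,M]$ put $I_r^\varepsilon=\{\lambda\in S:|\mathrm{Re}\,\lambda-r|<\varepsilon\}$, $J_r^\varepsilon=\{\lambda\in S:|\mathrm{Im}\,\lambda-r|<\varepsilon\}$; $r$ is *nice* if for all $\delta>0$ some $\varepsilon>0$ has $\mu^n(I_r^\varepsilon),\mu^n(J_r^\varepsilon)<\delta$. Fix a countable dense set $NI\ni\pm M$ of nice points of $[-M,M]$, and let $Sq^*$ be the family of open rectangles $\{\lambda\in S: r_0<\mathrm{Re}\,\lambda<r_1,\ r_2<\mathrm{Im}\,\lambda<r_3\}$, $r_i\in NI$. Let $\mu$ be the Borel measure $\mu(X)=\inf\{\sum_i\mu^n(X_i): X_i\in Sq^*,\ X\cap\mathrm{Int}\,S\subseteq\bigcup_i X_i\}$. Fix finite families $Sq_n\subseteq Sq^*$ of disjoint sets with $\bigcup_{X\in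 Sq_n}\overline X=S$ such that: for all $X\in Sq^*$ and $m$ there is $n>m$ such that $\overline X$ is a union of closures of members of $Sq_n$; for $n<m$ and $X\in Sq_n$, $\overline X$ is a union of closures of members of $Sq_m$; the members of $Sq_n$ are nonempty with side lengths $<2M/(n+1)$. **Kernel.** Let $B$ be a linear operator on $H$ and $K:S^2\to\mathbb C$ a continuous function whose restriction to $\sigma(A)^2$ is the kernel of $B$: for every $P\in\mathbb C[X,Y]$, with $f_P(\lambda)=P(\lambda,\overline\lambda)$, the operator $G^{-1}BG$ maps $f_P$ to $y\mapsto\int_{\sigma(A)}K(x,y)f_P(x)\,d\mu(x)$, where $G:L_2(\sigma(A),\mu)\to H$ is the isometry that extends $f_P\mapsto P(A,A^*)\phi$. Write $B_D(f)(y)=\int_SK(x,y)f(x)\,d\mu(x)$ and $F(f)=(F_N(f))_N$, $F_N(f)=\sum_k\xi_N(k)f(\lambda_N(k))u_N(k)$. **Ultraproduct.** Let $H^u=\prod_NH_N/D$. For $v=\sum_ka_ku_N(k)\in H_N$ put $\|v\|_\infty^X=\sup\{\xi_N(k)^{-1}|a_k|:\lambda_N(k)\in X\}$ (with $0^{-1}=0$)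 and $\|v\|_0=\sum_k\xi_N(k)|a_k|$. For $v=(v_N)\in H^u$, $v_N=\sum_ka^N_ku_N(k)$: if the numbers $\xi_N(k)^{-1}|a_k^N|$ are bounded uniformly for all $k$ and all $N$ in a set in $D$, put $\|v\|_\infty=\lim_{\varepsilon\to0}\lim_D\|v_N\|_\infty^{X_\varepsilon}$, $X_\varepsilon$ being the closed $\varepsilon$-neighbourhood of $\sigma(A)$; otherwise $\|v\|_\infty=\infty$. Let $[v]_\infty$ be the class of $v$ in $H^\infty_\infty=H^u/\!\sim_\infty$, where $v\sim_\infty w$ iff $\|v-w\|_\infty=0$, and $[v]_0$ the class modulo $\lim_D\|v_N-w_N\|_0=0$. $[v]_\infty\in H^m_\infty$ means $\|v\|_\infty<\infty$. $[v]_0\in H^m_0$ means that $\|v_N\|_0$ is bounded on a set in $D$ and $\lim_D\sum_{\lambda_N(k)\in T}\xi_N(k)|a^N_k|=0$ whenever $T$ is the union of the closures of some members of some $Sq_n$ and has positive distance from $\sigma(A)$. For classes $x,y$, $\langle x|y\rangle=q$ means that $\lim_D\langle f_N|g_N\rangle=q$ for all representatives $f\in x$, $g\in y$. **Grid.** Let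 $\alpha,\beta\in\sigma(A)$. Fix reals $r^n_i\in[-M,M]$ ($n\in\mathbb N$, $i\le 2^{n+2}$) with $0<r^n_{i+1}-r^n_i<2M/(n+1)$, $r^0_0=-M$, $r^0_4=M$, $\{r^n_i\}_i\subseteq\{r^{n+1}_j\}_j$, such that no $r^n_i$ is the real or imaginary part of $\alpha$ or $\beta$, and for all $n$ and $\delta>0$ some $\varepsilon>0$ has $\mu^n(R^n_\varepsilon)<\delta$, where $R^n_\varepsilon=\bigcup_i(I^\varepsilon_{r^n_i}\cup J^\varepsilon_{r^n_i})$. For $i,j<2^{n+2}$ let $B^n_{ij}=\{\lambda\in S:r^n_i<\mathrm{Re}\,\lambda<r^n_{i+1},\ r^n_j<\mathrm{Im}\,\lambda<r^n_{j+1}\}$, $\chi^*_{B^n_{ij}}=\chi_{B^n_{ij}}/\mu(B^n_{ij})$ if $\mu(B^n_{ij})>0$, and $u^n_{ij}(N)=\sum_{\lambda_N(k)\in B^n_{ij}}\frac{\xi_N(k)}{\mu_N(B^n_{ij})}u_N(k)$ ($0$ if $\mu_N(B^n_{ij})=0$). Write $B^p_\alpha$ for the $B^p_{ij}$ that contains $\alpha$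 and $u^p_\alpha$ for the corresponding sequence $(u^p_{ij}(N))_N$; similarly for $\beta$. **Operators.** Let $B_N$ be linear operators on $H_N$ and $B^u(v)=(B_Nv_N)_N$ such that * (C1)$'$ there is $K_D\in\mathbb N$ with $\|B_Nv\|^S_\infty\le K_D\|v\|_\infty^S$ for all $N$ and $v\in H_N$; * (C2)$'$ $[B^u(F(\chi^*_{B^n_{ij}}))]_\infty=[F(B_D(\chi^*_{B^n_{ij}}))]_\infty$ for all $B^n_{ij}$ with $\mu(B^n_{ij})>0$; * (C3)$'$ there is $p\in\mathbb N$ with $\|B_N(u^n_{ij}(N))\|_\infty^S<p$ for all $n$, all $i,j<2^{n+2}$ and all $N$. **Good pairs.** A generalized distribution is an antilinear $\theta:C(S)\to\mathbb C$ with $|\theta(f)|\le C\sup_{\sigma(A)}|f|$ for some $C$ and all $f$; $\theta_\alpha(f)=\overline{f(\alpha)}$. For $X\subseteq\mathbb C$ an $X$-function is an $f\in C(S)$ with $|f|\le1$ that vanishes off $X$. Let $\theta(B^n_{ij},1)=\lim_{\varepsilon\to0}\theta(f_\varepsilon)$, $f_\varepsilon$ being any $B^n_{ij}$-function that equals $1$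 where $r^n_i+\varepsilon<\mathrm{Re}<r^n_{i+1}-\varepsilon$ and $r^n_j+\varepsilon<\mathrm{Im}<r^n_{j+1}-\varepsilon$. A pair $n:\mathbb N\to\mathbb N$, $\varepsilon:\mathbb N\to(0,\infty)$ is $\theta$-good with witness $U\in D$ if: $\{N:n(N)>m,\ \varepsilon(N)<1/m\}\in D$ for all $m>0$; for all $N$ and all $i<2^{n(N)+2}$, each of $r^{n(N)}_i\pm\varepsilon(N)$ is nice or outside $[-M,M]$; and for $N\in U$ with $n=n(N)>0$, $\varepsilon=\varepsilon(N)$ and $\delta=2^{-3(n+2)}\min\{\mu_N(B^n_{ij}):\mu(B^n_{ij})>0\}$ we have $|\theta(f)|<\delta$ for all $R^n_\varepsilon$-functions $f$, $\mu_N(R^n_\varepsilon)<\delta$, and $|\mu_N(B^n_{ij})-\mu(B^n_{ij})|<\delta$ for all $i,j<2^{n+2}$. Put $$u_N(\theta)=\sum_{\mu(B^n_{ij})\ne0}\ \sum_{\lambda_N(k)\in B^n_{ij}}\frac{\xi_N(k)\,\theta(B^n_{ij},1)}{\mu_N(B^n_{ij})}u_N(k),\qquad n=n(N),\qquad u(\theta)=(u_N(\theta))_N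 .$$ **Proposition 5.4.** Let $(n,\varepsilon)$ be $\theta_\alpha$-good with witness $U_\alpha$ and $\theta_\beta$-good with witness $U_\beta$, such that for all $N\in U_\alpha\cap U_\beta$ with $p=n(N)>0$, $$\bigl|\langle u^p_\beta(N)|B_N(u^p_\alpha(N))\rangle-\lim_{N'\to D}\langle u^p_\beta(N')|B_{N'}(u^p_\alpha(N'))\rangle\bigr|<1/p .$$ Then $[u(\theta_\beta)]_0\in H^m_0$, $[B^u(u(\theta_\alpha))]_\infty\in H^m_\infty$, and $$K(\alpha,\beta)=\langle[u(\theta_\beta)]_0\,|\,[B^u(u(\theta_\alpha))]_\infty\rangle .$$ In particular, if $B^u$ induces a well-defined operator $B^\infty$ on $H^\infty_\infty$, $B^\infty([v]_\infty)=[B^u(v)]_\infty$, then $$K(\alpha,\beta)=\langle[u(\theta_\beta)]_0\,|\,B^\infty([u(\theta_\alpha)]_\infty)\rangle .$$ -/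

import Mathlib

open MeasureTheory Filter Topology Set

noncomputable section

namespace RiggedApprox

open scoped Classical

/-! ### Polynomials in an operator and its adjoint -/

section Operators

variable {H : Type*} [NormedAddCommGroup H] [InnerProductSpace ℂ H] [CompleteSpace H]

/-- `P(A, A*)` for a polynomial `P ∈ ℂ[X, Y]` (`X` is the variable `0` and `Y` the variable `1`). -/
def polyOp (A : H →L[ℂ] H) (P : MvPolynomial (Fin 2) ℂ) : H →L[ℂ] H :=
  ∑ m ∈ P.support, P.coeff m • (A ^ (m 0) * (ContinuousLinearMap.adjoint A) ^ (m 1))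

/-- `f_P(z) = P(z, conj z)`. -/
def polyFun (P : MvPolynomial (Fin 2) ℂ) (z : ℂ) : ℂ :=
  MvPolynomial.eval ![z, (starRingEnd ℂ) z] P

/-- `φ` is cyclic: the vectors `P(A, A*) φ` are dense. -/
def IsCyclic (A : H →L[ℂ] H) (φ : H) : Prop :=
  Dense (range fun P : MvPolynomial (Fin 2) ℂ => polyOp A P φ)

/-- `A^i (A*)^j φ`. -/
def mono (A : H →L[ℂ] H) (φ : H) (i j : ℕ) : H :=
  (A ^ i * (ContinuousLinearMap.adjoint A) ^ j) φ

/-- The finite dimensional space `H_N`. -/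
def HN (A : H →L[ℂ] H) (φ : H) (N : ℕ) : Submodule ℂ H :=
  Submodule.span ℂ {x | ∃ i j, i ≤ N ∧ j ≤ N ∧ x = mono A φ i j}

/-- The subspace `H_N^-` of `H_N`. -/
def HNminus (A : H →L[ℂ] H) (φ : H) (N : ℕ) : Submodule ℂ H :=
  Submodule.span ℂ {x | ∃ i j, i < N ∧ j ≤ N ∧ x = mono A φ i j}

/-- The subspace `H_N^+` of `H_N`. -/
def HNplus (A : H →L[ℂ] H) (φ : H) (N : ℕ) : Submodule ℂ H :=
  Submodule.span ℂ {x | ∃ i j, 0 < i ∧ i ≤ N ∧ j ≤ N ∧ x = mono A φ i j}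

/-- The orthogonal complement of `H_N^-` in `H_N`. -/
def Wminus (A : H →L[ℂ] H) (φ : H) (N : ℕ) : Submodule ℂ H := HN A φ N ⊓ (HNminus A φ N)ᗮ

/-- The orthogonal complement of `H_N^+` in `H_N`. -/
def Wplus (A : H →L[ℂ] H) (φ : H) (N : ℕ) : Submodule ℂ H := HN A φ N ⊓ (HNplus A φ N)ᗮ

end Operators

/-- The choices made in the construction of the finite dimensional approximations of `A`
(where `A A* = A* A = rA`) with unit cyclic vector `φ`: for every `N` a unitary map
`V N` from the orthogonal complement of `H_N^-` onto that of `H_N^+`, the operator `A_N` on `H_N`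
that it determines, an orthonormal eigenbasis `u_N(k)` of `A_N` with eigenvalues `lam N k`,
normalised so that the coordinates `xi N k = ⟨u_N(k) | φ⟩` are non-negative reals;
the bound `M`; and the ultrafilter `D`. -/
structure Setup {H : Type*} [NormedAddCommGroup H] [InnerProductSpace ℂ H] [CompleteSpace H]
    (A : H →L[ℂ] H) (rA : ℝ) (φ : H) where
  V : ∀ N, Wminus A φ N ≃ₗᵢ[ℂ] Wplus A φ N
  AN : ∀ N, HN A φ N →ₗ[ℂ] HN A φ N
  AN_minus : ∀ N (x : HN A φ N), (x : H) ∈ HNminus A φ N → (AN N x : H) = A x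
  AN_W : ∀ N (w : Wminus A φ N),
    (AN N ⟨(w : H), w.2.1⟩ : H) = ((Real.sqrt rA : ℝ) : ℂ) • (V N w : H)
  u : ∀ N, OrthonormalBasis (Fin (Module.finrank ℂ (HN A φ N))) ℂ (HN A φ N)
  lam : ∀ N, Fin (Module.finrank ℂ (HN A φ N)) → ℂ
  eigen : ∀ N k, AN N (u N k) = lam N k • u N k
  xi : ∀ N, Fin (Module.finrank ℂ (HN A φ N)) → ℝ
  xi_eq : ∀ N k, inner ℂ ((u N k : HN A φ N) : H) φ = (xi N k : ℂ)
  xi_nonneg : ∀ N k, 0 ≤ xi N k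
  M : ℕ
  norm_lt : ‖A‖ < M
  sqrt_lt : Real.sqrt rA < M
  D : Ultrafilter ℕ
  mem_D : ∀ m : ℕ, m ≠ 0 → {N : ℕ | N ≠ 0 ∧ ∃ s, N = s ^ 2 ∧ m ∣ s} ∈ D

namespace Setup

variable {H : Type*} [NormedAddCommGroup H] [InnerProductSpace ℂ H] [CompleteSpace H]
  {A : H →L[ℂ] H} {rA : ℝ} {φ : H} (Γ : Setup A rA φ)

/-- The square `S`. -/
def S : Set ℂ :=
  {z | (-(Γ.M : ℝ) ≤ z.re ∧ z.re ≤ Γ.M) ∧ (-(Γ.M : ℝ) ≤ z.im ∧ z.im ≤ Γ.M)}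

theorem spectrum_subset : spectrum ℂ A ⊆ Γ.S := by
  intro z hz
  have h1 : ‖z‖ ≤ ‖A‖ := by
    rcases subsingleton_or_nontrivial H with h | h
    · have : Subsingleton (H →L[ℂ] H) := inferInstance
      simp [spectrum.of_subsingleton] at hz
    · exact spectrum.norm_le_norm_of_mem hz
  have h2 := Γ.norm_lt
  have h3 := abs_le.1 (Complex.abs_re_le_norm z)
  have h4 := abs_le.1 (Complex.abs_im_le_norm z)
  exact ⟨⟨by linarith, by linarith⟩, by linarith, by linarith⟩

/-! ### The spectral measure -/

/-- The weighted counting measure `μ_N(X)`. -/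
def muN (N : ℕ) (X : Set ℂ) : ℝ := ∑ k, if Γ.lam N k ∈ X then Γ.xi N k ^ 2 else 0

/-- The naive measure: the ultralimit of the `μ_N(X)`. -/
def muNaive (X : Set ℂ) : ℝ := limUnder (Γ.D : Filter ℕ) fun N => Γ.muN N X

/-- The strip `I_r^ε`. -/
def stripI (r ε : ℝ) : Set ℂ := {z | z ∈ Γ.S ∧ |z.re - r| < ε}

/-- The strip `J_r^ε`. -/
def stripJ (r ε : ℝ) : Set ℂ := {z | z ∈ Γ.S ∧ |z.im - r| < ε}

/-- `r ∈ [-M, M]` is nice. -/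
def IsNice (r : ℝ) : Prop :=
  r ∈ Icc (-(Γ.M : ℝ)) Γ.M ∧
    ∀ δ > 0, ∃ ε > 0, Γ.muNaive (Γ.stripI r ε) < δ ∧ Γ.muNaive (Γ.stripJ r ε) < δ

/-- The open rectangle with sides `r₀ < Re < r₁` and `r₂ < Im < r₃` in `S`. -/
def rect (r₀ r₁ r₂ r₃ : ℝ) : Set ℂ :=
  {z | z ∈ Γ.S ∧ (r₀ < z.re ∧ z.re < r₁) ∧ (r₂ < z.im ∧ z.im < r₃)}

end Setup

/-- The choice of a countable dense set `NI` of nice reals, containing `-M` and `M`. -/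
structure NiceSet {H : Type*} [NormedAddCommGroup H] [InnerProductSpace ℂ H] [CompleteSpace H]
    {A : H →L[ℂ] H} {rA : ℝ} {φ : H} (Γ : Setup A rA φ) where
  NI : Set ℝ
  countable : NI.Countable
  nice : ∀ r ∈ NI, Γ.IsNice r
  dense : Icc (-(Γ.M : ℝ)) Γ.M ⊆ closure NI
  left_mem : -(Γ.M : ℝ) ∈ NI
  right_mem : (Γ.M : ℝ) ∈ NI

namespace NiceSet

variable {H : Type*} [NormedAddCommGroup H] [InnerProductSpace ℂ H] [CompleteSpace H]
  {A : H →L[ℂ] H} {rA : ℝ} {φ : H} {Γ : Setup A rA φ} (ν : NiceSet Γ)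

/-- The family `Sq*` of open rectangles with sides in `NI`. -/
def SqStar : Set (Set ℂ) :=
  {Y | ∃ r₀ ∈ ν.NI, ∃ r₁ ∈ ν.NI, ∃ r₂ ∈ ν.NI, ∃ r₃ ∈ ν.NI, Y = Γ.rect r₀ r₁ r₂ r₃}

/-- The naive measure on `Sq*`, and `∞` on other sets. -/
def preMeasure (X : Set ℂ) : ENNReal := ⨅ _ : X ∈ ν.SqStar, ENNReal.ofReal (Γ.muNaive X)

/-- The outer measure `μ*`: the infimum of `∑ μⁿ(X_i)` over the countable covers by members
of `Sq*` of the part of the set that lies in the interior of `S`. -/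
def outer : OuterMeasure ℂ :=
  OuterMeasure.restrict (interior Γ.S) (OuterMeasure.boundedBy ν.preMeasure)

end NiceSet

/-! ### Borel sets are Carathéodory measurable for `μ*` -/

section Caratheodory

variable {H : Type*} [NormedAddCommGroup H] [InnerProductSpace ℂ H] [CompleteSpace H]
  {A : H →L[ℂ] H} {rA : ℝ} {φ : H} {Γ : Setup A rA φ}

theorem Setup.muN_nonneg (N : ℕ) (X : Set ℂ) : 0 ≤ Γ.muN N X :=
  Finset.sum_nonneg fun k _ => by split_ifs <;> positivity

theorem Setup.muN_le (N : ℕ) (X : Set ℂ) : Γ.muN N X ≤ ‖φ‖ ^ 2 := by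
  have hφ : φ ∈ HN A φ N :=
    Submodule.subset_span ⟨0, 0, Nat.zero_le _, Nat.zero_le _, by simp [mono]⟩
  have h := (Γ.u N).sum_sq_norm_inner_right ⟨φ, hφ⟩
  have h2 : ∀ k, ‖inner ℂ (Γ.u N k) (⟨φ, hφ⟩ : HN A φ N)‖ ^ 2 = Γ.xi N k ^ 2 := by
    intro k
    rw [Submodule.coe_inner, Γ.xi_eq N k]
    simp
  simp only [h2] at h
  calc Γ.muN N X ≤ ∑ k, Γ.xi N k ^ 2 :=
        Finset.sum_le_sum fun k _ => by split_ifs <;> [exact le_rfl; positivity]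
    _ = ‖φ‖ ^ 2 := by rw [h]; rfl

theorem Setup.tendsto_muN (X : Set ℂ) :
    Tendsto (fun N => Γ.muN N X) (Γ.D : Filter ℕ) (𝓝 (Γ.muNaive X)) := by
  apply tendsto_nhds_limUnder
  have h := (isCompact_Icc (a := (0 : ℝ)) (b := ‖φ‖ ^ 2)).ultrafilter_le_nhds
    (Γ.D.map fun N => Γ.muN N X) (by
      rw [le_principal_iff, Ultrafilter.mem_coe, Ultrafilter.mem_map]
      exact univ_mem' fun N => ⟨Setup.muN_nonneg N X, Setup.muN_le N X⟩)
  obtain ⟨x, _, hx⟩ := h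
  exact ⟨x, hx⟩

theorem Setup.muNaive_nonneg (X : Set ℂ) : 0 ≤ Γ.muNaive X :=
  ge_of_tendsto' (Γ.tendsto_muN X) fun N => Setup.muN_nonneg N X

theorem Setup.muN_add_le (N : ℕ) {X Y Z : Set ℂ} (hd : Disjoint X Y) (h : X ∪ Y ⊆ Z) :
    Γ.muN N X + Γ.muN N Y ≤ Γ.muN N Z := by
  unfold Setup.muN
  rw [← Finset.sum_add_distrib]
  refine Finset.sum_le_sum fun k _ => ?_
  by_cases hX : Γ.lam N k ∈ X
  · have hY : Γ.lam N k ∉ Y := fun hY => disjoint_left.1 hd hX hY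
    simp [hX, hY, h (Or.inl hX)]
  · by_cases hY : Γ.lam N k ∈ Y
    · simp [hX, hY, h (Or.inr hY)]
    · simp only [hX, hY, if_false, add_zero]
      split_ifs <;> positivity

theorem Setup.muN_le_add (N : ℕ) {X Y Z : Set ℂ} (h : Z ⊆ X ∪ Y) :
    Γ.muN N Z ≤ Γ.muN N X + Γ.muN N Y := by
  unfold Setup.muN
  rw [← Finset.sum_add_distrib]
  refine Finset.sum_le_sum fun k _ => ?_
  by_cases hZ : Γ.lam N k ∈ Z
  · rcases h hZ with h1 | h1
    · simp only [hZ, h1, if_true]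
      have : (0 : ℝ) ≤ if Γ.lam N k ∈ Y then Γ.xi N k ^ 2 else 0 := by split_ifs <;> positivity
      linarith
    · simp only [hZ, h1, if_true]
      have : (0 : ℝ) ≤ if Γ.lam N k ∈ X then Γ.xi N k ^ 2 else 0 := by split_ifs <;> positivity
      linarith
  · simp only [hZ, if_false]
    refine add_nonneg ?_ ?_ <;> split_ifs <;> positivity

theorem Setup.muNaive_add_le {X Y Z : Set ℂ} (hd : Disjoint X Y) (h : X ∪ Y ⊆ Z) :
    Γ.muNaive X + Γ.muNaive Y ≤ Γ.muNaive Z :=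
  le_of_tendsto_of_tendsto' ((Γ.tendsto_muN X).add (Γ.tendsto_muN Y)) (Γ.tendsto_muN Z)
    fun N => Setup.muN_add_le N hd h

theorem Setup.muNaive_le_add {X Y Z : Set ℂ} (h : Z ⊆ X ∪ Y) :
    Γ.muNaive Z ≤ Γ.muNaive X + Γ.muNaive Y :=
  le_of_tendsto_of_tendsto' (Γ.tendsto_muN Z) ((Γ.tendsto_muN X).add (Γ.tendsto_muN Y))
    fun N => Setup.muN_le_add N h

variable (ν : NiceSet Γ)

theorem NiceSet.boundedBy_le {X Y : Set ℂ} (hY : Y ∈ ν.SqStar) (h : X ⊆ Y) :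
    OuterMeasure.boundedBy ν.preMeasure X ≤ ENNReal.ofReal (Γ.muNaive Y) :=
  ((OuterMeasure.mono _ h).trans (OuterMeasure.boundedBy_le Y)).trans (iInf_le _ hY)

/-- A set is Carathéodory measurable for `μ*` if it splits the members of `Sq*` correctly. -/
theorem NiceSet.caratheodory_of_split (C : Set ℂ)
    (h : ∀ X ∈ ν.SqStar, ∀ δ : ℝ, 0 < δ → ∃ Y₁ ∈ ν.SqStar, ∃ Y₂ ∈ ν.SqStar,
      X ∩ C ⊆ Y₁ ∧ X \ C ⊆ Y₂ ∧ Γ.muNaive Y₁ + Γ.muNaive Y₂ ≤ Γ.muNaive X + δ) :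
    MeasurableSet[ν.outer.caratheodory] C := by
  have hm : ∀ T, OuterMeasure.boundedBy ν.preMeasure (T ∩ C) +
      OuterMeasure.boundedBy ν.preMeasure (T \ C) ≤ OuterMeasure.boundedBy ν.preMeasure T := by
    intro T
    conv_rhs => rw [OuterMeasure.boundedBy_apply]
    refine le_iInf fun t => le_iInf fun ht => ?_
    have h1 : T ∩ C ⊆ ⋃ n, t n ∩ C := by
      rw [← iUnion_inter]; exact inter_subset_inter_left _ ht
    have h2 : T \ C ⊆ ⋃ n, t n \ C := by
      rw [← iUnion_sdiff]; exact sdiff_subset_sdiff_left ht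
    refine (add_le_add ((measure_mono h1).trans (measure_iUnion_le _))
      ((measure_mono h2).trans (measure_iUnion_le _))).trans ?_
    rw [← ENNReal.tsum_add]
    refine ENNReal.tsum_le_tsum fun n => ?_
    rcases (t n).eq_empty_or_nonempty with he | hne
    · simp [he]
    · simp only [hne, iSup_pos]
      refine le_iInf fun hX => ?_
      refine ENNReal.le_of_forall_pos_le_add fun δ hδ _ => ?_
      obtain ⟨Y₁, hY₁, Y₂, hY₂, hs₁, hs₂, hle⟩ := h _ hX δ (by exact_mod_cast hδ)
      refine (add_le_add (ν.boundedBy_le hY₁ hs₁) (ν.boundedBy_le hY₂ hs₂)).trans ?_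
      rw [← ENNReal.ofReal_add (Setup.muNaive_nonneg _) (Setup.muNaive_nonneg _),
        ← ENNReal.ofReal_coe_nnreal (p := δ),
        ← ENNReal.ofReal_add (Setup.muNaive_nonneg _) δ.coe_nonneg]
      exact ENNReal.ofReal_le_ofReal hle
  refine (OuterMeasure.isCaratheodory_iff_le _).2 fun T => ?_
  simp only [NiceSet.outer, OuterMeasure.restrict_apply]
  have e1 : T ∩ C ∩ interior Γ.S = T ∩ interior Γ.S ∩ C := by
    ext z; simp only [mem_inter_iff]; tauto
  have e2 : T \ C ∩ interior Γ.S = (T ∩ interior Γ.S) \ C := by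
    ext z; simp only [mem_inter_iff, Set.mem_sdiff]; tauto
  rw [e1, e2]
  exact hm _

theorem NiceSet.exists_between {r η : ℝ} (hr : r ∈ ν.NI) (hη : 0 < η)
    (hr' : -(Γ.M : ℝ) < r) : ∃ s ∈ ν.NI, r - η < s ∧ s < r := by
  have hlt : max (-(Γ.M : ℝ)) (r - η) < r := max_lt hr' (by linarith)
  obtain ⟨x, hx1, hx2⟩ := _root_.exists_between hlt
  have hxm : x ∈ closure ν.NI :=
    ν.dense ⟨((le_max_left _ _).trans_lt hx1).le, hx2.le.trans (ν.nice r hr).1.2⟩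
  obtain ⟨s, hs, hsN⟩ := mem_closure_iff.1 hxm (Ioo (max (-(Γ.M : ℝ)) (r - η)) r) isOpen_Ioo
    ⟨hx1, hx2⟩
  exact ⟨s, hsN, (le_max_right _ _).trans_lt hs.1, hs.2⟩

theorem NiceSet.max_mem {a b : ℝ} (ha : a ∈ ν.NI) (hb : b ∈ ν.NI) : max a b ∈ ν.NI := by
  rcases max_choice a b with h | h <;> rw [h] <;> assumption

theorem NiceSet.min_mem {a b : ℝ} (ha : a ∈ ν.NI) (hb : b ∈ ν.NI) : min a b ∈ ν.NI := by
  rcases min_choice a b with h | h <;> rw [h] <;> assumption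

theorem NiceSet.measurable_re_NI {r : ℝ} (hr : r ∈ ν.NI) :
    MeasurableSet[ν.outer.caratheodory] {z : ℂ | z.re < r} := by
  refine ν.caratheodory_of_split _ ?_
  rintro X ⟨r₀, h₀, r₁, h₁, r₂, h₂, r₃, h₃, rfl⟩ δ hδ
  rcases (ν.nice r hr).1.1.eq_or_lt with he | hlt
  · refine ⟨Γ.rect r r r r, ⟨r, hr, r, hr, r, hr, r, hr, rfl⟩, Γ.rect r₀ r₁ r₂ r₃,
      ⟨r₀, h₀, r₁, h₁, r₂, h₂, r₃, h₃, rfl⟩, ?_, sdiff_subset, ?_⟩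
    · rintro z ⟨hz, hz2⟩
      have h5 := hz.1.1.1
      simp only [mem_ofPred_eq] at hz2
      linarith
    · have h6 : Γ.muNaive (Γ.rect r r r r) + Γ.muNaive (Γ.rect r₀ r₁ r₂ r₃)
          ≤ Γ.muNaive (Γ.rect r₀ r₁ r₂ r₃) := by
        refine Setup.muNaive_add_le ?_ ?_
        · refine disjoint_left.2 fun z hz => ?_
          have := hz.2.1.1.trans hz.2.1.2
          exact (lt_irrefl _ this).elim
        · rintro z (hz | hz)
          · have := hz.2.1.1.trans hz.2.1.2
            exact (lt_irrefl _ this).elim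
          · exact hz
      linarith
  · obtain ⟨ε, hε, hI, -⟩ := (ν.nice r hr).2 δ hδ
    obtain ⟨s, hs, hs1, hs2⟩ := ν.exists_between hr hε hlt
    refine ⟨Γ.rect r₀ (min r₁ r) r₂ r₃, ⟨r₀, h₀, _, ν.min_mem h₁ hr, r₂, h₂, r₃, h₃, rfl⟩,
      Γ.rect (max r₀ s) r₁ r₂ r₃, ⟨_, ν.max_mem h₀ hs, r₁, h₁, r₂, h₂, r₃, h₃, rfl⟩, ?_, ?_, ?_⟩
    · rintro z ⟨hz, hz2⟩
      exact ⟨hz.1, ⟨hz.2.1.1, lt_min hz.2.1.2 hz2⟩, hz.2.2⟩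
    · rintro z ⟨hz, hz2⟩
      simp only [mem_ofPred_eq, not_lt] at hz2
      exact ⟨hz.1, ⟨max_lt hz.2.1.1 (by linarith), hz.2.1.2⟩, hz.2.2⟩
    · have a1 : Γ.muNaive (Γ.rect (max r₀ s) r₁ r₂ r₃) ≤
          Γ.muNaive (Γ.rect r₀ r₁ r₂ r₃ \ {z : ℂ | z.re < r}) + Γ.muNaive (Γ.stripI r ε) := by
        refine Setup.muNaive_le_add fun z hz => ?_
        by_cases hzr : z.re < r
        · right
          refine ⟨hz.1, ?_⟩
          have := (le_max_right _ _).trans_lt hz.2.1.1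
          rw [abs_lt]
          constructor <;> linarith
        · left
          exact ⟨⟨hz.1, ⟨(le_max_left _ _).trans_lt hz.2.1.1, hz.2.1.2⟩, hz.2.2⟩, hzr⟩
      have a2 : Γ.muNaive (Γ.rect r₀ (min r₁ r) r₂ r₃) +
          Γ.muNaive (Γ.rect r₀ r₁ r₂ r₃ \ {z : ℂ | z.re < r}) ≤
            Γ.muNaive (Γ.rect r₀ r₁ r₂ r₃) := by
        refine Setup.muNaive_add_le ?_ ?_
        · refine disjoint_left.2 fun z hz hz2 => hz2.2 ?_
          exact hz.2.1.2.trans_le (min_le_right _ _)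
        · rintro z (hz | hz)
          · exact ⟨hz.1, ⟨hz.2.1.1, hz.2.1.2.trans_le (min_le_left _ _)⟩, hz.2.2⟩
          · exact hz.1
      linarith

theorem NiceSet.measurable_im_NI {r : ℝ} (hr : r ∈ ν.NI) :
    MeasurableSet[ν.outer.caratheodory] {z : ℂ | z.im < r} := by
  refine ν.caratheodory_of_split _ ?_
  rintro X ⟨r₀, h₀, r₁, h₁, r₂, h₂, r₃, h₃, rfl⟩ δ hδ
  rcases (ν.nice r hr).1.1.eq_or_lt with he | hlt
  · refine ⟨Γ.rect r r r r, ⟨r, hr, r, hr, r, hr, r, hr, rfl⟩, Γ.rect r₀ r₁ r₂ r₃,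
      ⟨r₀, h₀, r₁, h₁, r₂, h₂, r₃, h₃, rfl⟩, ?_, sdiff_subset, ?_⟩
    · rintro z ⟨hz, hz2⟩
      have h5 := hz.1.2.1
      simp only [mem_ofPred_eq] at hz2
      linarith
    · have h6 : Γ.muNaive (Γ.rect r r r r) + Γ.muNaive (Γ.rect r₀ r₁ r₂ r₃)
          ≤ Γ.muNaive (Γ.rect r₀ r₁ r₂ r₃) := by
        refine Setup.muNaive_add_le ?_ ?_
        · refine disjoint_left.2 fun z hz => ?_
          have := hz.2.1.1.trans hz.2.1.2
          exact (lt_irrefl _ this).elim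
        · rintro z (hz | hz)
          · have := hz.2.1.1.trans hz.2.1.2
            exact (lt_irrefl _ this).elim
          · exact hz
      linarith
  · obtain ⟨ε, hε, -, hJ⟩ := (ν.nice r hr).2 δ hδ
    obtain ⟨s, hs, hs1, hs2⟩ := ν.exists_between hr hε hlt
    refine ⟨Γ.rect r₀ r₁ r₂ (min r₃ r), ⟨r₀, h₀, r₁, h₁, r₂, h₂, _, ν.min_mem h₃ hr, rfl⟩,
      Γ.rect r₀ r₁ (max r₂ s) r₃, ⟨r₀, h₀, r₁, h₁, _, ν.max_mem h₂ hs, r₃, h₃, rfl⟩, ?_, ?_, ?_⟩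
    · rintro z ⟨hz, hz2⟩
      exact ⟨hz.1, hz.2.1, hz.2.2.1, lt_min hz.2.2.2 hz2⟩
    · rintro z ⟨hz, hz2⟩
      simp only [mem_ofPred_eq, not_lt] at hz2
      exact ⟨hz.1, hz.2.1, max_lt hz.2.2.1 (by linarith), hz.2.2.2⟩
    · have a1 : Γ.muNaive (Γ.rect r₀ r₁ (max r₂ s) r₃) ≤
          Γ.muNaive (Γ.rect r₀ r₁ r₂ r₃ \ {z : ℂ | z.im < r}) + Γ.muNaive (Γ.stripJ r ε) := by
        refine Setup.muNaive_le_add fun z hz => ?_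
        by_cases hzr : z.im < r
        · right
          refine ⟨hz.1, ?_⟩
          have := (le_max_right _ _).trans_lt hz.2.2.1
          rw [abs_lt]
          constructor <;> linarith
        · left
          exact ⟨⟨hz.1, hz.2.1, (le_max_left _ _).trans_lt hz.2.2.1, hz.2.2.2⟩, hzr⟩
      have a2 : Γ.muNaive (Γ.rect r₀ r₁ r₂ (min r₃ r)) +
          Γ.muNaive (Γ.rect r₀ r₁ r₂ r₃ \ {z : ℂ | z.im < r}) ≤
            Γ.muNaive (Γ.rect r₀ r₁ r₂ r₃) := by
        refine Setup.muNaive_add_le ?_ ?_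
        · refine disjoint_left.2 fun z hz hz2 => hz2.2 ?_
          exact hz.2.2.2.trans_le (min_le_right _ _)
        · rintro z (hz | hz)
          · exact ⟨hz.1, hz.2.1, hz.2.2.1, hz.2.2.2.trans_le (min_le_left _ _)⟩
          · exact hz.1
      linarith

theorem NiceSet.measurable_of_NI (f : ℂ → ℝ)
    (hf : ∀ z ∈ Γ.S, f z ∈ Icc (-(Γ.M : ℝ)) Γ.M)
    (h : ∀ r ∈ ν.NI, MeasurableSet[ν.outer.caratheodory] {z : ℂ | f z < r}) (r : ℝ) :
    MeasurableSet[ν.outer.caratheodory] {z : ℂ | f z < r} := by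
  by_cases h1 : r ≤ -(Γ.M : ℝ)
  · refine ν.caratheodory_of_split _ ?_
    rintro X ⟨r₀, h₀, r₁, h₁, r₂, h₂, r₃, h₃, rfl⟩ δ hδ
    refine ⟨Γ.rect r₀ r₀ r₂ r₃, ⟨r₀, h₀, r₀, h₀, r₂, h₂, r₃, h₃, rfl⟩, Γ.rect r₀ r₁ r₂ r₃,
      ⟨r₀, h₀, r₁, h₁, r₂, h₂, r₃, h₃, rfl⟩, ?_, sdiff_subset, ?_⟩
    · rintro z ⟨hz, hz2⟩
      have := (hf z hz.1).1
      simp only [mem_ofPred_eq] at hz2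
      linarith
    · have h6 : Γ.muNaive (Γ.rect r₀ r₀ r₂ r₃) + Γ.muNaive (Γ.rect r₀ r₁ r₂ r₃)
          ≤ Γ.muNaive (Γ.rect r₀ r₁ r₂ r₃) := by
        refine Setup.muNaive_add_le ?_ ?_
        · refine disjoint_left.2 fun z hz => ?_
          exact (lt_irrefl _ (hz.2.1.1.trans hz.2.1.2)).elim
        · rintro z (hz | hz)
          · exact (lt_irrefl _ (hz.2.1.1.trans hz.2.1.2)).elim
          · exact hz
      linarith
  by_cases h2 : (Γ.M : ℝ) < r
  · refine ν.caratheodory_of_split _ ?_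
    rintro X ⟨r₀, h₀, r₁, h₁, r₂, h₂', r₃, h₃, rfl⟩ δ hδ
    refine ⟨Γ.rect r₀ r₁ r₂ r₃, ⟨r₀, h₀, r₁, h₁, r₂, h₂', r₃, h₃, rfl⟩, Γ.rect r₀ r₀ r₂ r₃,
      ⟨r₀, h₀, r₀, h₀, r₂, h₂', r₃, h₃, rfl⟩, inter_subset_left, ?_, ?_⟩
    · rintro z ⟨hz, hz2⟩
      have := (hf z hz.1).2
      simp only [mem_ofPred_eq, not_lt] at hz2
      linarith
    · have h6 : Γ.muNaive (Γ.rect r₀ r₁ r₂ r₃) + Γ.muNaive (Γ.rect r₀ r₀ r₂ r₃)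
          ≤ Γ.muNaive (Γ.rect r₀ r₁ r₂ r₃) := by
        refine Setup.muNaive_add_le ?_ ?_
        · refine disjoint_right.2 fun z hz => ?_
          exact (lt_irrefl _ (hz.2.1.1.trans hz.2.1.2)).elim
        · rintro z (hz | hz)
          · exact hz
          · exact (lt_irrefl _ (hz.2.1.1.trans hz.2.1.2)).elim
      linarith
  push Not at h1 h2
  have he : {z : ℂ | f z < r} = ⋃ s ∈ ν.NI ∩ Iio r, {z : ℂ | f z < s} := by
    ext z
    simp only [mem_ofPred_eq, mem_iUnion, mem_inter_iff, mem_Iio, exists_prop]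
    constructor
    · intro hz
      have hlt : max (-(Γ.M : ℝ)) (f z) < r := max_lt h1 hz
      obtain ⟨x, hx1, hx2⟩ := _root_.exists_between hlt
      have hxm : x ∈ closure ν.NI :=
        ν.dense ⟨((le_max_left _ _).trans_lt hx1).le, hx2.le.trans h2⟩
      obtain ⟨s, hs, hsN⟩ := mem_closure_iff.1 hxm (Ioo (max (-(Γ.M : ℝ)) (f z)) r) isOpen_Ioo
        ⟨hx1, hx2⟩
      exact ⟨s, ⟨hsN, hs.2⟩, (le_max_right _ _).trans_lt hs.1⟩
    · rintro ⟨s, ⟨_, hs⟩, hz⟩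
      exact hz.trans hs
  rw [he]
  exact @MeasurableSet.biUnion _ _ ν.outer.caratheodory _ _
    (ν.countable.mono inter_subset_left) fun s hs => h s hs.1

theorem measurable_complex_of_halfplanes {X : Type*} [MeasurableSpace X] (f : X → ℂ)
    (hre : ∀ r : ℝ, MeasurableSet {x : X | (f x).re < r})
    (him : ∀ r : ℝ, MeasurableSet {x : X | (f x).im < r}) : Measurable f := by
  have h1 : Measurable fun x => (f x).re := measurable_of_Iio hre
  have h2 : Measurable fun x => (f x).im := measurable_of_Iio him
  have h3 : Measurable fun x => ((f x).re : ℂ) + (f x).im * Complex.I :=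
    (Complex.measurable_ofReal.comp h1).add ((Complex.measurable_ofReal.comp h2).mul_const _)
  simpa [Complex.re_add_im] using h3

theorem NiceSet.borel_le : Complex.measurableSpace ≤ ν.outer.caratheodory := fun s hs =>
  @measurable_complex_of_halfplanes ℂ ν.outer.caratheodory id
    (ν.measurable_of_NI Complex.re (fun _ hz => hz.1) fun _ hr => ν.measurable_re_NI hr)
    (ν.measurable_of_NI Complex.im (fun _ hz => hz.2) fun _ hr => ν.measurable_im_NI hr) s hs

end Caratheodory

/-- The spectral measure `μ`: the restriction of `μ*` to the Borel sets. -/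
def NiceSet.mu {H : Type*} [NormedAddCommGroup H] [InnerProductSpace ℂ H] [CompleteSpace H]
    {A : H →L[ℂ] H} {rA : ℝ} {φ : H} {Γ : Setup A rA φ} (ν : NiceSet Γ) : Measure ℂ :=
  ν.outer.toMeasure ν.borel_le

/-- The choice of the finite families `Sq_n ⊆ Sq*`. -/
structure SquareFamily {H : Type*} [NormedAddCommGroup H] [InnerProductSpace ℂ H]
    [CompleteSpace H] {A : H →L[ℂ] H} {rA : ℝ} {φ : H} {Γ : Setup A rA φ} (ν : NiceSet Γ) where
  Sq : ℕ → Set (Set ℂ)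
  finite : ∀ n, (Sq n).Finite
  subset : ∀ n, Sq n ⊆ ν.SqStar
  disjoint : ∀ n, ∀ X ∈ Sq n, ∀ Y ∈ Sq n, X ≠ Y → Disjoint X Y
  cover : ∀ n, ⋃ X ∈ Sq n, closure X = Γ.S
  exhaust : ∀ X ∈ ν.SqStar, ∀ m : ℕ, ∃ n, m < n ∧ ∃ Z ⊆ Sq n, closure X = ⋃ Y ∈ Z, closure Y
  refines : ∀ n m, n < m → ∀ X ∈ Sq n, ∃ Z ⊆ Sq m, closure X = ⋃ Y ∈ Z, closure Y
  small : ∀ n, ∀ Y ∈ Sq n, ∃ r₀ ∈ ν.NI, ∃ r₁ ∈ ν.NI, ∃ r₂ ∈ ν.NI, ∃ r₃ ∈ ν.NI,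
    Y = Γ.rect r₀ r₁ r₂ r₃ ∧ r₀ < r₁ ∧ r₁ - r₀ < 2 * Γ.M / (n + 1) ∧
      r₂ < r₃ ∧ r₃ - r₂ < 2 * Γ.M / (n + 1)

/-! ### Sequences of vectors, the norms, and the classes `[v]_0` and `[v]_∞` -/

/-- Sequences `(v_N)` with `v_N ∈ H_N`; they represent the elements of the ultraproduct `H^u`.
All relations below depend on such a sequence only up to equality on a set in `D`. -/
abbrev Vec {H : Type*} [NormedAddCommGroup H] [InnerProductSpace ℂ H] [CompleteSpace H]
    (A : H →L[ℂ] H) (φ : H) : Type _ := ∀ N, HN A φ N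

/-- The sequence `(B_N v_N)`, which represents `B^u(v)`. -/
def applyU {H : Type*} [NormedAddCommGroup H] [InnerProductSpace ℂ H] [CompleteSpace H]
    {A : H →L[ℂ] H} {φ : H} (BN : ∀ N, HN A φ N →ₗ[ℂ] HN A φ N) (v : Vec A φ) :
    Vec A φ := fun N => BN N (v N)

namespace Setup

variable {H : Type*} [NormedAddCommGroup H] [InnerProductSpace ℂ H] [CompleteSpace H]
  {A : H →L[ℂ] H} {rA : ℝ} {φ : H} (Γ : Setup A rA φ)

/-- The coordinate of `v ∈ H_N` at the eigenvector `u_N(k)`. -/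
def coef (N : ℕ) (v : HN A φ N) (k : Fin (Module.finrank ℂ (HN A φ N))) : ℂ := (Γ.u N).repr v k

/-- `F_N(f) = ∑ ξ_N(k) f(λ_N(k)) u_N(k)`. -/
def F (f : ℂ → ℂ) : Vec A φ := fun N => ∑ k, ((Γ.xi N k : ℂ) * f (Γ.lam N k)) • Γ.u N k

/-- The sup norm `‖v‖_∞^X` on `H_N` (the supremum over the empty set is `0`). -/
def supNorm (N : ℕ) (X : Set ℂ) (v : HN A φ N) : ℝ :=
  ⨆ k : {k // Γ.lam N k ∈ X}, (Γ.xi N k)⁻¹ * ‖Γ.coef N v k‖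

/-- The norm `‖v‖_0` on `H_N`. -/
def norm0 (N : ℕ) (v : HN A φ N) : ℝ := ∑ k, Γ.xi N k * ‖Γ.coef N v k‖

/-- `‖v‖_∞^ε`: the ultralimit of the sup norms over the closed `ε`-neighbourhood of `σ(A)`. -/
def normInfEps (ε : ℝ) (v : Vec A φ) : ℝ :=
  limUnder (Γ.D : Filter ℕ) fun N => Γ.supNorm N (Metric.cthickening ε (spectrum ℂ A)) (v N)

/-- `‖v‖_∞`: the limit of `‖v‖_∞^ε` as `ε → 0` if the numbers `ξ_N(k)⁻¹ |a_k^N|` are bounded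
for all `N` in a set in `D` (then all the limits exist), and `∞` otherwise. -/
def normInf (v : Vec A φ) : ENNReal :=
  if ∃ p : ℕ, ∀ᶠ N in (Γ.D : Filter ℕ), ∀ k, (Γ.xi N k)⁻¹ * ‖Γ.coef N (v N) k‖ < p then
    ENNReal.ofReal (limUnder (𝓝[>] (0 : ℝ)) fun ε => Γ.normInfEps ε v)
  else ⊤

/-- `v ∈ H^{m∞}`. -/
def IsHmInf (v : Vec A φ) : Prop := Γ.normInf v < ⊤

/-- The class `[v]_∞` in `H^∞_∞ = H^u / ∼_∞`. -/
def clsInf (v : Vec A φ) : Set (Vec A φ) := {w | Γ.normInf (w - v) = 0}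

/-- The class `[v]_0` in `H^u / ∼_0`. -/
def cls0 (v : Vec A φ) : Set (Vec A φ) :=
  {w | Tendsto (fun N => Γ.norm0 N (w N - v N)) (Γ.D : Filter ℕ) (𝓝 0)}

/-- `⟨x | y⟩ = q` for classes `x` and `y`: `⟨f | g⟩^u` is infinitely close to `q` for all
representatives `f ∈ x` and `g ∈ y`. -/
def HasPairing (x y : Set (Vec A φ)) (q : ℂ) : Prop :=
  ∀ f ∈ x, ∀ g ∈ y, Tendsto (fun N => inner ℂ (f N) (g N)) (Γ.D : Filter ℕ) (𝓝 q)

/-- The vector `∑_{λ_N(k) ∈ X} (ξ_N(k) / μ_N(X)) u_N(k)` of `H_N`; it is `0` if `μ_N(X) = 0`. -/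
def avgVec (X : Set ℂ) : Vec A φ := fun N =>
  ∑ k, if Γ.lam N k ∈ X then ((Γ.xi N k : ℂ) / (Γ.muN N X : ℂ)) • Γ.u N k else 0

/-- `f ∈ C(S)` is an `X`-function. -/
def IsFunOn (X : Set ℂ) (f : C(Γ.S, ℂ)) : Prop :=
  ∀ z : Γ.S, ‖f z‖ ≤ 1 ∧ ((z : ℂ) ∉ X → f z = 0)

end Setup

/-- `v ∈ H^{m0}`: the sequence is `0`-good and has finite `‖·‖_0`-norm. A set `Y ⊆ Sq_n` is good
if the union `S_1^Y` of the closures of the members of `Sq_n \ Y` has positive distance from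
`σ(A)`. -/
def SquareFamily.IsHm0 {H : Type*} [NormedAddCommGroup H] [InnerProductSpace ℂ H]
    [CompleteSpace H] {A : H →L[ℂ] H} {rA : ℝ} {φ : H} {Γ : Setup A rA φ} {ν : NiceSet Γ}
    (Q : SquareFamily ν) (v : Vec A φ) : Prop :=
  (∀ n, ∀ Y ⊆ Q.Sq n,
    (∃ d > 0, ∀ z ∈ spectrum ℂ A, ∀ w ∈ ⋃ R ∈ Q.Sq n \ Y, closure R, d ≤ dist z w) →
    Tendsto (fun N => ∑ k, if Γ.lam N k ∈ ⋃ R ∈ Q.Sq n \ Y, closure R then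
      Γ.xi N k * ‖Γ.coef N (v N) k‖ else 0) (Γ.D : Filter ℕ) (𝓝 0)) ∧
  ∃ n : ℕ, ∀ᶠ N in (Γ.D : Filter ℕ), Γ.norm0 N (v N) < n

/-! ### The grid, generalised distributions and good pairs -/

/-- The choice of the reals `r^n_i ∈ [-M, M]`, `i < 2^(n+2) + 1`, such that no line of the grid
contains `α` or `β` and small neighbourhoods of the lines have small naive measure. -/
structure Grid {H : Type*} [NormedAddCommGroup H] [InnerProductSpace ℂ H] [CompleteSpace H]
    {A : H →L[ℂ] H} {rA : ℝ} {φ : H} (Γ : Setup A rA φ) (α β : ℂ) where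
  r : ℕ → ℕ → ℝ
  mem : ∀ n i, i < 2 ^ (n + 2) + 1 → r n i ∈ Icc (-(Γ.M : ℝ)) Γ.M
  step : ∀ n i, i < 2 ^ (n + 2) →
    r n i < r n (i + 1) ∧ r n (i + 1) - r n i < 2 * Γ.M / (n + 1)
  left : r 0 0 = -(Γ.M : ℝ)
  right : r 0 4 = Γ.M
  refines : ∀ n i, i < 2 ^ (n + 2) + 1 → ∃ j < 2 ^ (n + 3) + 1, r n i = r (n + 1) j
  avoid : ∀ n i, i < 2 ^ (n + 2) + 1 →
    r n i ≠ α.re ∧ r n i ≠ α.im ∧ r n i ≠ β.re ∧ r n i ≠ β.im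
  thin : ∀ n, ∀ δ > 0, ∃ ε > 0,
    Γ.muNaive {z | ∃ i < 2 ^ (n + 2) + 1, z ∈ Γ.stripI (r n i) ε ∪ Γ.stripJ (r n i) ε} < δ

/-- A generalised distribution: an antilinear map on `C(S)` that is bounded with respect to the
supremum over `σ(A)`. -/
structure GenDist {H : Type*} [NormedAddCommGroup H] [InnerProductSpace ℂ H] [CompleteSpace H]
    {A : H →L[ℂ] H} {rA : ℝ} {φ : H} (Γ : Setup A rA φ) where
  toMap : C(Γ.S, ℂ) →ₛₗ[starRingEnd ℂ] ℂ
  bounded : ∃ K : ℕ, ∀ f : C(Γ.S, ℂ), ∀ c : ℝ,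
    (∀ z : Γ.S, (z : ℂ) ∈ spectrum ℂ A → ‖f z‖ ≤ c) → ‖toMap f‖ ≤ K * c

/-- The Dirac delta at `α ∈ σ(A)`, as an antilinear map. -/
def Setup.dirac {H : Type*} [NormedAddCommGroup H] [InnerProductSpace ℂ H] [CompleteSpace H]
    {A : H →L[ℂ] H} {rA : ℝ} {φ : H} (Γ : Setup A rA φ) (α : spectrum ℂ A) : GenDist Γ where
  toMap :=
    { toFun := fun f => (starRingEnd ℂ) (f ⟨α, Γ.spectrum_subset α.2⟩)
      map_add' := fun f g => by simp
      map_smul' := fun c f => by simp }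
  bounded := ⟨1, fun f c h => by simpa using h ⟨α, Γ.spectrum_subset α.2⟩ α.2⟩

namespace Grid

variable {H : Type*} [NormedAddCommGroup H] [InnerProductSpace ℂ H] [CompleteSpace H]
  {A : H →L[ℂ] H} {rA : ℝ} {φ : H} {Γ : Setup A rA φ} {α β : ℂ} (g : Grid Γ α β)

/-- The box `B^n_{ij}`. -/
def box (n i j : ℕ) : Set ℂ := Γ.rect (g.r n i) (g.r n (i + 1)) (g.r n j) (g.r n (j + 1))

/-- The set `R^n_ε`. -/
def R (n : ℕ) (ε : ℝ) : Set ℂ :=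
  {z | ∃ i < 2 ^ (n + 2) + 1, z ∈ Γ.stripI (g.r n i) ε ∪ Γ.stripJ (g.r n i) ε}

/-- The box of level `n` that contains `z`. -/
def boxAt (n : ℕ) (z : ℂ) : Set ℂ :=
  {w | ∃ i < 2 ^ (n + 2), ∃ j < 2 ^ (n + 2), z ∈ g.box n i j ∧ w ∈ g.box n i j}

/-- The `B^n_{ij}`-functions that are equal to `1` at distance more than `ε` from the grid lines
that bound the box. -/
def plateau (n i j : ℕ) (ε : ℝ) : Set C(Γ.S, ℂ) :=
  {f | Γ.IsFunOn (g.box n i j) f ∧ ∀ z : Γ.S,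
    (g.r n i + ε < (z : ℂ).re ∧ (z : ℂ).re < g.r n (i + 1) - ε) →
    (g.r n j + ε < (z : ℂ).im ∧ (z : ℂ).im < g.r n (j + 1) - ε) → f z = 1}

/-- `θ(B^n_{ij}, 1)`: the limit as `ε → 0` of the values of `θ` at plateau functions. -/
def boxValue (θ : GenDist Γ) (n i j : ℕ) : ℂ :=
  limUnder (⨅ ε ∈ Ioi (0 : ℝ), 𝓟 (g.plateau n i j ε)) fun f => θ.toMap f

/-- `ε` is very nice for `n`. -/
def VeryNice (n : ℕ) (ε : ℝ) : Prop :=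
  ∀ i < 2 ^ (n + 2),
    (Γ.IsNice (g.r n i - ε) ∨ g.r n i - ε < -(Γ.M : ℝ) ∨ (Γ.M : ℝ) < g.r n i - ε) ∧
    (Γ.IsNice (g.r n i + ε) ∨ g.r n i + ε < -(Γ.M : ℝ) ∨ (Γ.M : ℝ) < g.r n i + ε)

variable (ν : NiceSet Γ)

/-- The number `δ(N)`, for `n = n(N)`. -/
def delta (n N : ℕ) : ℝ :=
  sInf {x | ∃ i < 2 ^ (n + 2), ∃ j < 2 ^ (n + 2),
    0 < ν.mu.real (g.box n i j) ∧ x = Γ.muN N (g.box n i j)} / 2 ^ (3 * (n + 2))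

/-- The pair `(n, ε)` is `θ`-good, witnessed by the set `U = U(θ, n, ε)`. -/
structure IsGood (θ : GenDist Γ) (n : ℕ → ℕ) (ε : ℕ → ℝ) (U : Set ℕ) : Prop where
  pos : ∀ N, 0 < ε N
  tends : ∀ m : ℕ, 0 < m → {N | m < n N ∧ ε N < 1 / m} ∈ Γ.D
  mem : U ∈ Γ.D
  small_dist : ∀ N ∈ U, 0 < n N → ∀ f, Γ.IsFunOn (g.R (n N) (ε N)) f →
    ‖θ.toMap f‖ < g.delta ν (n N) N
  small_measure : ∀ N ∈ U, 0 < n N → Γ.muN N (g.R (n N) (ε N)) < g.delta ν (n N) N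
  close : ∀ N ∈ U, 0 < n N → ∀ i < 2 ^ (n N + 2), ∀ j < 2 ^ (n N + 2),
    |Γ.muN N (g.box (n N) i j) - ν.mu.real (g.box (n N) i j)| < g.delta ν (n N) N
  nice : ∀ N, g.VeryNice (n N) (ε N)

/-- The vector `u(θ)` determined by the function `n` of a good pair. -/
def uVec (θ : GenDist Γ) (n : ℕ → ℕ) : Vec A φ := fun N =>
  ∑ i ∈ Finset.range (2 ^ (n N + 2)), ∑ j ∈ Finset.range (2 ^ (n N + 2)),
    if ν.mu (g.box (n N) i j) ≠ 0 then
      ∑ k, if Γ.lam N k ∈ g.box (n N) i j then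
        ((Γ.xi N k : ℂ) * g.boxValue θ (n N) i j / (Γ.muN N (g.box (n N) i j) : ℂ)) • Γ.u N k
      else 0
    else 0

/-! ### Kernels and the conditions on the operators `B_N` -/

/-- `χ*`: the characteristic function of `B^n_{ij}` divided by `μ(B^n_{ij})`. -/
def chiStar (n i j : ℕ) : ℂ → ℂ :=
  (g.box n i j).indicator fun _ => ((ν.mu.real (g.box n i j))⁻¹ : ℂ)

end Grid

section Kernel

variable {H : Type*} [NormedAddCommGroup H] [InnerProductSpace ℂ H] [CompleteSpace H]
  {A : H →L[ℂ] H} {rA : ℝ} {φ : H} {Γ : Setup A rA φ} (ν : NiceSet Γ)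

/-- `ψ = G(f)`, where `G` is the isometry from `L₂(σ(A), μ)` onto `H` that extends
`f_P ↦ P(A, A*) φ` by continuity. -/
def NiceSet.IsG (f : ℂ → ℂ) (ψ : H) : Prop :=
  ∀ δ : ℝ, 0 < δ → ∃ P : MvPolynomial (Fin 2) ℂ, ‖ψ - polyOp A P φ‖ < δ ∧
    eLpNorm (fun x => f x - polyFun P x) 2 (ν.mu.restrict (spectrum ℂ A)) < ENNReal.ofReal δ

/-- `K` is the kernel of the operator `B` on `H`: for every polynomial `P`, the operator
`B_D = G⁻¹ B G` maps `f_P` to the function `y ↦ ∫_{σ(A)} K(x, y) f_P(x) dμ(x)`. -/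
def NiceSet.IsKernel (B : H →ₗ[ℂ] H) (K : ℂ × ℂ → ℂ) : Prop :=
  ∀ P : MvPolynomial (Fin 2) ℂ,
    ν.IsG (fun y => ∫ x in spectrum ℂ A, K (x, y) * polyFun P x ∂ν.mu) (B (polyOp A P φ))

/-- `B_D(f)(y) = ∫_S K(x, y) f(x) dμ(x)`. -/
def NiceSet.BD (K : ℂ × ℂ → ℂ) (f : ℂ → ℂ) (y : ℂ) : ℂ := ∫ x in Γ.S, K (x, y) * f x ∂ν.mu

variable (BN : ∀ N, HN A φ N →ₗ[ℂ] HN A φ N)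

/-- The operators `B_N` are uniformly bounded in the sup norm over `S`. -/
def CondOne (Γ : Setup A rA φ) : Prop :=
  ∃ K : ℕ, ∀ N (v : HN A φ N), Γ.supNorm N Γ.S (BN N v) ≤ K * Γ.supNorm N Γ.S v

variable {α β : ℂ} (g : Grid Γ α β)

/-- `B^∞([F(χ*)]_∞) = [F(B_D(χ*))]_∞` for the normalised characteristic functions `χ*` of all the
boxes of positive measure. -/
def CondTwo (K : ℂ × ℂ → ℂ) : Prop :=
  ∀ n, ∀ i < 2 ^ (n + 2), ∀ j < 2 ^ (n + 2), ν.mu (g.box n i j) ≠ 0 →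
    Γ.clsInf (applyU BN (Γ.F (g.chiStar ν n i j))) =
      Γ.clsInf (Γ.F (ν.BD K (g.chiStar ν n i j)))

/-- The images of the averaged box vectors `u^n_{ij}(N)` are uniformly bounded in the sup norm
over `S`. -/
def CondThree : Prop :=
  ∃ p : ℕ, ∀ n, ∀ i < 2 ^ (n + 2), ∀ j < 2 ^ (n + 2), ∀ N,
    Γ.supNorm N Γ.S (BN N (Γ.avgVec (g.box n i j) N)) < p

/-- The additional requirement on the pair `(n, ε)` on a set `U`: for `N ∈ U` and `p = n(N) > 0`
the number `⟨u^p_β(N) | B_N(u^p_α(N))⟩` differs by less than `1/p` from its ultralimit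
`⟨u^p_β | B^u(u^p_α)⟩` (`p` fixed). -/
def CondStar (n : ℕ → ℕ) (U : Set ℕ) : Prop :=
  ∀ N ∈ U, ∀ p : ℕ, p = n N → 0 < p →
    ‖inner ℂ (Γ.avgVec (g.boxAt p β) N) (BN N (Γ.avgVec (g.boxAt p α) N)) -
      limUnder (Γ.D : Filter ℕ) (fun N' =>
        inner ℂ (Γ.avgVec (g.boxAt p β) N') (BN N' (Γ.avgVec (g.boxAt p α) N')))‖ < 1 / p

end Kernel

end RiggedApprox
end

open MeasureTheory Filter Topology Set

noncomputable section

namespace RiggedApprox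

open scoped Classical

/-! ### Eigenvalues, weights and moments of the finite dimensional approximations. -/

section FiniteApproximation

variable {H : Type*} [NormedAddCommGroup H] [InnerProductSpace ℂ H] [CompleteSpace H]
  {A : H →L[ℂ] H} {rA : ℝ} {φ : H}

/-! Paired with `F(h)`, the vector averaged over a set `Y` returns the mean of `h` over `Y` with
respect to `μ_N`. The grid lines avoid `α` and `β`, so at each level exactly one box contains `α`,
and it has positive measure. Hence `u(θ_α)` at `N` is the average over the box of level `p = n(N)`
around `α` (`Grid.uVec_dirac`), likewise for `β`, and the number to compute is `⟨u^p_β(N) | B_N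
u^p_α(N)⟩` with `p = n(N)`.

Fix `p` first. Up to a scalar tending to 1, `u^p_α` is `F(χ*)`, and (C2)' replaces `B^u F(χ*)` by
`F(B_D χ*)`, where `B_D χ*` at `y` is the mean of `K(·, y)` over the box of `α`. The ultralimit is
therefore a limit of double means of `K` over the two boxes, and it differs from `K(α, β)` by at
most the oscillation of `K` there (`NiceSet.norm_lim_sub_le`). The boxes shrink, so continuity of
`K` makes this small for large `p`. The extra requirement on the good pair transfers the estimate
from the ultralimit at level `p` to the index `N` with `n(N) = p`.

Independence of representatives is a Hölder inequality between `‖·‖_0` and `‖·‖_∞`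
(`Setup.norm_inner_le`). Since `‖·‖_∞` only sees coordinates near `σ(A)`, the others need separate
control: for a fixed box their weight tends to 0 (`Setup.tendsto_muN_compl_cthickening`), and the
shrinking boxes around `β` eventually lie near `σ(A)`.

The spectral input is `∑ ξ_N(k)² F(λ_N(k)) → ⟨φ | F(A) φ⟩` (`Setup.tendsto_sum_cfc`), which gives
concentration near `σ(A)` and positivity around its points; `Grid.mu_box` identifies `μ` with the
naive measure on boxes. -/

theorem apply_mono (A : H →L[ℂ] H) (φ : H) (i j : ℕ) :
    A (mono A φ i j) = mono A φ (i + 1) j := by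
  simp [mono, pow_succ']

theorem apply_mono_zero_succ
    (hA' : A * ContinuousLinearMap.adjoint A = (rA : ℂ) • (1 : H →L[ℂ] H)) (φ : H) (j : ℕ) :
    A (mono A φ 0 (j + 1)) = (rA : ℂ) • mono A φ 0 j := by
  have := congrArg (fun T : H →L[ℂ] H => T ((ContinuousLinearMap.adjoint A ^ j) φ)) hA'
  simpa [mono, pow_succ'] using this

theorem norm_apply_sq (hA : ContinuousLinearMap.adjoint A * A = (rA : ℂ) • (1 : H →L[ℂ] H))
    (x : H) : ‖A x‖ ^ 2 = rA * ‖x‖ ^ 2 := by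
  have h := congrArg (fun T : H →L[ℂ] H => inner ℂ x (T x)) hA
  simp only [mul_apply_eq_comp, ContinuousLinearMap.adjoint_inner_right,
    _root_.smul_apply, one_apply_eq_self, inner_smul_right,
    inner_self_eq_norm_sq_to_K] at h
  refine Complex.ofReal_injective ?_
  push_cast
  exact h

theorem mono_mem {N i j : ℕ} (hi : i ≤ N) (hj : j ≤ N) : mono A φ i j ∈ HN A φ N :=
  Submodule.subset_span ⟨i, j, hi, hj, rfl⟩

theorem mono_mem_minus {N i j : ℕ} (hi : i < N) (hj : j ≤ N) : mono A φ i j ∈ HNminus A φ N :=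
  Submodule.subset_span ⟨i, j, hi, hj, rfl⟩

theorem HNminus_le (A : H →L[ℂ] H) (φ : H) (N : ℕ) : HNminus A φ N ≤ HN A φ N := by
  refine Submodule.span_le.2 ?_
  rintro _ ⟨i, j, hi, hj, rfl⟩
  exact mono_mem hi.le hj

theorem apply_mem_plus {N : ℕ} {x : H} (hx : x ∈ HNminus A φ N) : A x ∈ HNplus A φ N := by
  have : HNminus A φ N ≤ (HNplus A φ N).comap A.toLinearMap := by
    refine Submodule.span_le.2 ?_
    rintro _ ⟨i, j, hi, hj, rfl⟩
    exact Submodule.subset_span ⟨i + 1, j, i.succ_pos, hi, hj, apply_mono A φ i j⟩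
  exact this hx

theorem mem_HN (A : H →L[ℂ] H) (φ : H) (N : ℕ) : φ ∈ HN A φ N := by
  simpa [mono] using mono_mem (A := A) (φ := φ) (Nat.zero_le N) (Nat.zero_le N)

namespace Setup

variable (Γ : Setup A rA φ)

include Γ in
theorem finiteDimensional_HN (N : ℕ) : FiniteDimensional ℂ (HN A φ N) :=
  (Γ.u N).toBasis.finiteDimensional_of_finite

/-- Both pieces of `A_N` scale lengths by `√rA`, and they map `H_N^-` into `H_N^+` and its
complement into the orthogonal complement of `H_N^+`. Pythagoras then applies before and after. -/
theorem norm_AN_sq (hr : 0 ≤ rA)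
    (hA : ContinuousLinearMap.adjoint A * A = (rA : ℂ) • (1 : H →L[ℂ] H))
    (N : ℕ) (x : HN A φ N) : ‖Γ.AN N x‖ ^ 2 = rA * ‖x‖ ^ 2 := by
  have := Γ.finiteDimensional_HN N
  have : FiniteDimensional ℂ (HNminus A φ N) :=
    Submodule.finiteDimensional_of_le (HNminus_le A φ N)
  obtain ⟨y, hy, w, hw, hxyw⟩ := (HNminus A φ N).exists_add_mem_mem_orthogonal (x : H)
  have hyH := HNminus_le A φ N hy
  have hwH : w ∈ HN A φ N := by
    have : w = (x : H) - y := by rw [hxyw]; abel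
    rw [this]; exact Submodule.sub_mem _ x.2 hyH
  have hx : x = ⟨y, hyH⟩ + ⟨w, hwH⟩ := Subtype.ext hxyw
  have e1 := Γ.AN_minus N ⟨y, hyH⟩ hy
  have hwW : w ∈ Wminus A φ N := ⟨hwH, hw⟩
  have e2 : (Γ.AN N ⟨w, hwH⟩ : H) = ((Real.sqrt rA : ℝ) : ℂ) • (Γ.V N ⟨w, hwW⟩ : H) :=
    Γ.AN_W N ⟨w, hwW⟩
  have e3 : ‖(Γ.V N ⟨w, hwW⟩ : H)‖ = ‖w‖ := (Γ.V N).norm_map ⟨w, hwW⟩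
  have h1 : ‖(Γ.AN N x : H)‖ ^ 2 = ‖A y‖ ^ 2 + rA * ‖w‖ ^ 2 := by
    rw [hx, map_add, Submodule.coe_add, e1, e2, sq,
      norm_add_sq_eq_norm_sq_add_norm_sq_of_inner_eq_zero (𝕜 := ℂ), norm_smul, e3]
    · simp only [Complex.norm_real, Real.norm_eq_abs, abs_of_nonneg (Real.sqrt_nonneg _)]
      rw [mul_mul_mul_comm, Real.mul_self_sqrt hr, ← sq, ← sq]
    · rw [inner_smul_right,
        (Submodule.mem_orthogonal _ _).1 (Γ.V N ⟨w, hwW⟩).2.2 _ (apply_mem_plus hy), mul_zero]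
  have h2 : ‖(x : H)‖ ^ 2 = ‖y‖ ^ 2 + ‖w‖ ^ 2 := by
    rw [hxyw, sq, norm_add_sq_eq_norm_sq_add_norm_sq_of_inner_eq_zero (𝕜 := ℂ), ← sq, ← sq]
    exact (Submodule.mem_orthogonal _ _).1 hw _ hy
  rw [Submodule.coe_norm, Submodule.coe_norm, h1, h2, norm_apply_sq hA]
  ring

theorem norm_lam_sq (hr : 0 ≤ rA)
    (hA : ContinuousLinearMap.adjoint A * A = (rA : ℂ) • (1 : H →L[ℂ] H))
    (N : ℕ) (k) : ‖Γ.lam N k‖ ^ 2 = rA := by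
  have h := Γ.norm_AN_sq hr hA N (Γ.u N k)
  rw [Γ.eigen, norm_smul, (Γ.u N).norm_eq_one] at h
  simpa using h

theorem norm_lam_lt (hr : 0 ≤ rA)
    (hA : ContinuousLinearMap.adjoint A * A = (rA : ℂ) • (1 : H →L[ℂ] H))
    (N : ℕ) (k) : ‖Γ.lam N k‖ < Γ.M := by
  rw [← Real.sqrt_sq (norm_nonneg (Γ.lam N k)), Γ.norm_lam_sq hr hA]
  exact Γ.sqrt_lt

theorem mem_S_of_norm_lt {z : ℂ} (hz : ‖z‖ ≤ Γ.M) : z ∈ Γ.S := by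
  have h3 := abs_le.1 ((Complex.abs_re_le_norm z).trans hz)
  have h4 := abs_le.1 ((Complex.abs_im_le_norm z).trans hz)
  exact ⟨h3, h4⟩

theorem lam_mem_S (hr : 0 ≤ rA)
    (hA : ContinuousLinearMap.adjoint A * A = (rA : ℂ) • (1 : H →L[ℂ] H))
    (N : ℕ) (k) : Γ.lam N k ∈ Γ.S :=
  Γ.mem_S_of_norm_lt (Γ.norm_lam_lt hr hA N k).le

theorem coef_eq_inner (N : ℕ) (v : HN A φ N) (k) : Γ.coef N v k = inner ℂ (Γ.u N k) v :=
  (Γ.u N).repr_apply_apply v k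

theorem inner_AN (N : ℕ) (x : HN A φ N) (k) :
    inner ℂ (Γ.u N k) (Γ.AN N x) = Γ.lam N k * inner ℂ (Γ.u N k) x := by
  conv_lhs => rw [← (Γ.u N).sum_repr x]
  simp only [map_sum, map_smul, Γ.eigen, inner_sum, inner_smul_right,
    OrthonormalBasis.inner_eq_ite]
  simp [(Γ.u N).repr_apply_apply, mul_comm]

/-- Where `A_N` agrees with `A`, applying `A` multiplies the coordinate by `λ`. Powers of `A*` are
reached by reading this backwards: `A A* = rA = λ conj λ`, and the nonzero `λ` cancels. -/
theorem inner_mono (hr : 0 < rA)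
    (hA : ContinuousLinearMap.adjoint A * A = (rA : ℂ) • (1 : H →L[ℂ] H))
    (hA' : A * ContinuousLinearMap.adjoint A = (rA : ℂ) • (1 : H →L[ℂ] H))
    {N i j : ℕ} (hi : i ≤ N) (hj : j ≤ N) (k) :
    inner ℂ (Γ.u N k : H) (mono A φ i j) =
      Γ.lam N k ^ i * (starRingEnd ℂ) (Γ.lam N k) ^ j * Γ.xi N k := by
  have step : ∀ {i j}, i < N → j ≤ N → inner ℂ (Γ.u N k : H) (A (mono A φ i j)) =
      Γ.lam N k * inner ℂ (Γ.u N k : H) (mono A φ i j) := by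
    intro i j hi hj
    have := Γ.inner_AN N ⟨mono A φ i j, mono_mem hi.le hj⟩ k
    rwa [Submodule.coe_inner, Γ.AN_minus N _ (mono_mem_minus hi hj), Submodule.coe_inner] at this
  have hl : Γ.lam N k * (starRingEnd ℂ) (Γ.lam N k) = rA := by
    rw [Complex.mul_conj, Complex.normSq_eq_norm_sq, Γ.norm_lam_sq hr.le hA]
  have hl0 : Γ.lam N k ≠ 0 := by
    intro h0
    rw [h0, zero_mul] at hl
    exact hr.ne (by exact_mod_cast hl)
  have h0 : ∀ j, j ≤ N → inner ℂ (Γ.u N k : H) (mono A φ 0 j) =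
      (starRingEnd ℂ) (Γ.lam N k) ^ j * Γ.xi N k := by
    intro j
    induction j with
    | zero => intro _; simpa [mono] using Γ.xi_eq N k
    | succ j ih =>
      intro hj
      -- The bound `0 < N` needed here comes from `j + 1 ≤ N`.
      have h := step (i := 0) (j := j + 1) (by omega) hj
      rw [apply_mono_zero_succ hA', inner_smul_right, ih (by omega), ← hl] at h
      refine (mul_left_cancel₀ hl0 ?_).symm
      rw [← h, pow_succ']; ring
  clear hl hl0
  induction i with
  | zero => rw [h0 j hj]; simp
  | succ i ih => rw [← apply_mono, step (by omega) hj, ih (by omega)]; ring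

/-- If the weight vanished, every spanning vector of `H_N` would be orthogonal to `u_N(k)`, a unit
vector of `H_N`. -/
theorem xi_pos (hr : 0 < rA)
    (hA : ContinuousLinearMap.adjoint A * A = (rA : ℂ) • (1 : H →L[ℂ] H))
    (hA' : A * ContinuousLinearMap.adjoint A = (rA : ℂ) • (1 : H →L[ℂ] H))
    (N : ℕ) (k) : 0 < Γ.xi N k := by
  refine (Γ.xi_nonneg N k).lt_of_ne' fun h0 => ?_
  have hle : HN A φ N ≤ (ℂ ∙ (Γ.u N k : H))ᗮ := by
    refine Submodule.span_le.2 ?_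
    rintro _ ⟨i, j, hi, hj, rfl⟩
    refine Submodule.mem_orthogonal_singleton_iff_inner_right.2 ?_
    rw [Γ.inner_mono hr hA hA' hi hj, h0]; simp
  have h := Submodule.mem_orthogonal_singleton_iff_inner_right.1 (hle (Γ.u N k).2)
  have h1 := (Γ.u N).norm_eq_one k
  rw [inner_self_eq_zero] at h
  rw [Submodule.coe_norm, h, norm_zero] at h1
  exact zero_ne_one h1

theorem sum_moment (hr : 0 < rA)
    (hA : ContinuousLinearMap.adjoint A * A = (rA : ℂ) • (1 : H →L[ℂ] H))
    (hA' : A * ContinuousLinearMap.adjoint A = (rA : ℂ) • (1 : H →L[ℂ] H))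
    {N i j : ℕ} (hi : i ≤ N) (hj : j ≤ N) :
    ∑ k, (Γ.xi N k : ℂ) ^ 2 * (Γ.lam N k ^ i * (starRingEnd ℂ) (Γ.lam N k) ^ j) =
      inner ℂ φ (mono A φ i j) := by
  have h := (Γ.u N).sum_inner_mul_inner ⟨φ, mem_HN A φ N⟩ ⟨mono A φ i j, mono_mem hi hj⟩
  rw [Submodule.coe_inner] at h
  rw [← h]
  refine Finset.sum_congr rfl fun k _ => ?_
  rw [Submodule.coe_inner, Submodule.coe_inner, ← inner_conj_symm]
  simp only
  rw [Γ.xi_eq, Γ.inner_mono hr hA hA' hi hj, Complex.conj_ofReal]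
  ring

theorem eventually_ge (m : ℕ) : ∀ᶠ N in (Γ.D : Filter ℕ), m ≤ N := by
  filter_upwards [Γ.mem_D (m + 1) m.succ_ne_zero]
  rintro N ⟨hN, s, rfl, hs⟩
  have hs0 : 0 < s := Nat.pos_of_ne_zero (by rintro rfl; simp at hN)
  have := Nat.le_of_dvd hs0 hs
  nlinarith

end Setup
end FiniteApproximation

/-! ### Convergence of the weighted eigenvalue sums to the functional calculus. -/

section SpectralLimit

theorem continuous_polyFun (P : MvPolynomial (Fin 2) ℂ) : Continuous (polyFun P) := by
  unfold polyFun
  simp only [MvPolynomial.eval_eq']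
  refine continuous_finsetSum _ fun m _ => continuous_const.mul ?_
  simp only [Fin.prod_univ_two, Matrix.cons_val_zero, Matrix.cons_val_one]
  fun_prop

theorem polyFun_eq_sum (P : MvPolynomial (Fin 2) ℂ) (z : ℂ) :
    polyFun P z = ∑ m ∈ P.support, P.coeff m * (z ^ m 0 * (starRingEnd ℂ) z ^ m 1) := by
  simp [polyFun, MvPolynomial.eval_eq', Fin.prod_univ_two]

/-- The functions `z ↦ P(z, conj z)` on a set, as a star subalgebra. -/
def polyFunSubalgebra (s : Set ℂ) : StarSubalgebra ℂ C(s, ℂ) where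
  carrier := range fun P : MvPolynomial (Fin 2) ℂ =>
    (⟨fun z : s => polyFun P z, (continuous_polyFun P).comp continuous_subtype_val⟩ : C(s, ℂ))
  mul_mem' := by
    rintro _ _ ⟨P, rfl⟩ ⟨P', rfl⟩
    exact ⟨P * P', by ext z; simp [polyFun]⟩
  add_mem' := by
    rintro _ _ ⟨P, rfl⟩ ⟨P', rfl⟩
    exact ⟨P + P', by ext z; simp [polyFun]⟩
  algebraMap_mem' c := ⟨MvPolynomial.C c, by ext z; simp [polyFun]⟩
  star_mem' := by
    rintro _ ⟨P, rfl⟩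
    -- Conjugating `P(z, conj z)` conjugates the coefficients and swaps the two variables.
    refine ⟨MvPolynomial.rename (Equiv.swap 0 1) (MvPolynomial.map (starRingEnd ℂ) P), ?_⟩
    ext z
    simp only [polyFun, ContinuousMap.coe_mk, ContinuousMap.star_apply, MvPolynomial.eval_rename,
      MvPolynomial.eval_map, RCLike.star_def]
    rw [← MvPolynomial.eval₂_id, MvPolynomial.hom_eval₂]
    congr 1
    ext i
    fin_cases i <;> simp

/-- Stone–Weierstrass. It is applied on the disc of radius `M`, which contains both `σ(A)` and all
the `λ_N(k)`. -/
theorem exists_polyFun_near {s : Set ℂ} (hs : IsCompact s) {F : ℂ → ℂ} (hF : Continuous F)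
    {δ : ℝ} (hδ : 0 < δ) : ∃ P : MvPolynomial (Fin 2) ℂ, ∀ z ∈ s, ‖F z - polyFun P z‖ < δ := by
  have : CompactSpace s := isCompact_iff_compactSpace.1 hs
  have htop := ContinuousMap.starSubalgebra_topologicalClosure_eq_top_of_separatesPoints
    (polyFunSubalgebra s) (by
      intro x y hxy
      refine ⟨_, ⟨_, ⟨MvPolynomial.X 0, rfl⟩, rfl⟩, ?_⟩
      simpa [polyFun] using fun h => hxy (Subtype.ext h))
  have hmem : (⟨fun z : s => F z, hF.comp continuous_subtype_val⟩ : C(s, ℂ)) ∈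
      closure ((polyFunSubalgebra s : StarSubalgebra ℂ C(s, ℂ)) : Set C(s, ℂ)) := by
    rw [← StarSubalgebra.topologicalClosure_coe, htop]; trivial
  obtain ⟨_, ⟨P, rfl⟩, hP⟩ := Metric.mem_closure_iff.1 hmem δ hδ
  refine ⟨P, fun z hz => ?_⟩
  have := (ContinuousMap.dist_apply_le_dist (⟨z, hz⟩ : s)).trans_lt hP
  simpa [dist_eq_norm] using this

variable {H : Type*} [NormedAddCommGroup H] [InnerProductSpace ℂ H] [CompleteSpace H]
  {A : H →L[ℂ] H} {rA : ℝ} {φ : H}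

theorem isStarNormal_of_eq
    (hA : ContinuousLinearMap.adjoint A * A = (rA : ℂ) • (1 : H →L[ℂ] H))
    (hA' : A * ContinuousLinearMap.adjoint A = (rA : ℂ) • (1 : H →L[ℂ] H)) : IsStarNormal A :=
  ⟨by rw [ContinuousLinearMap.star_eq_adjoint]; exact hA.trans hA'.symm⟩

theorem cfc_polyFun [IsStarNormal A] (P : MvPolynomial (Fin 2) ℂ) :
    cfc (polyFun P) A = polyOp A P := by
  have : polyFun P = ∑ m ∈ P.support, fun z : ℂ =>
      P.coeff m • (z ^ m 0 * star z ^ m 1) := by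
    ext z; simp [polyFun_eq_sum]
  rw [this, cfc_sum (fun m (z : ℂ) => P.coeff m • (z ^ m 0 * star z ^ m 1)) A P.support
    (fun m _ => by fun_prop)]
  refine Finset.sum_congr rfl fun m _ => ?_
  rw [cfc_smul (P.coeff m) (fun z : ℂ => z ^ m 0 * star z ^ m 1) A (by fun_prop),
    cfc_mul (fun z : ℂ => z ^ m 0) (fun z => star z ^ m 1) A (by fun_prop) (by fun_prop),
    cfc_pow (fun z : ℂ => z) _ A, cfc_pow (fun z : ℂ => star z) _ A, cfc_star_id (a := A), cfc_id' ℂ A,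
    ContinuousLinearMap.star_eq_adjoint]

theorem polyOp_apply (A : H →L[ℂ] H) (P : MvPolynomial (Fin 2) ℂ) (φ : H) :
    polyOp A P φ = ∑ m ∈ P.support, P.coeff m • mono A φ (m 0) (m 1) := by
  simp [polyOp, mono]

namespace Setup

variable (Γ : Setup A rA φ)

theorem sum_xi_sq (N : ℕ) : ∑ k, Γ.xi N k ^ 2 = ‖φ‖ ^ 2 := by
  have h := (Γ.u N).sum_sq_norm_inner_right ⟨φ, mem_HN A φ N⟩
  rw [Submodule.coe_norm] at h
  rw [← h]
  refine Finset.sum_congr rfl fun k _ => ?_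
  rw [Submodule.coe_inner, Γ.xi_eq N k]
  simp

/-- The moments are exact as soon as `N` exceeds the degree of `P` in each variable, so no limit is
involved. -/
theorem eventually_sum_polyFun (hr : 0 < rA)
    (hA : ContinuousLinearMap.adjoint A * A = (rA : ℂ) • (1 : H →L[ℂ] H))
    (hA' : A * ContinuousLinearMap.adjoint A = (rA : ℂ) • (1 : H →L[ℂ] H))
    (P : MvPolynomial (Fin 2) ℂ) :
    ∀ᶠ N in (Γ.D : Filter ℕ),
      ∑ k, (Γ.xi N k : ℂ) ^ 2 * polyFun P (Γ.lam N k) = inner ℂ φ (polyOp A P φ) := by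
  filter_upwards [Γ.eventually_ge (P.support.sup fun m => m 0),
    Γ.eventually_ge (P.support.sup fun m => m 1)] with N h0 h1
  rw [polyOp_apply, inner_sum]
  simp only [polyFun_eq_sum, Finset.mul_sum]
  rw [Finset.sum_comm]
  refine Finset.sum_congr rfl fun m hm => ?_
  rw [inner_smul_right, ← Γ.sum_moment hr hA hA' ((Finset.le_sup (f := fun m => m 0) hm).trans h0)
    ((Finset.le_sup (f := fun m => m 1) hm).trans h1), Finset.mul_sum]
  exact Finset.sum_congr rfl fun k _ => by ring

/-- Both sides change by at most the sup of the change of `F` on the disc of radius `M`: the weights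
sum to `‖φ‖² = 1`, and the functional calculus is contractive. Polynomial approximation reduces to
the exact case. -/
theorem tendsto_sum_cfc (hr : 0 < rA)
    (hA : ContinuousLinearMap.adjoint A * A = (rA : ℂ) • (1 : H →L[ℂ] H))
    (hA' : A * ContinuousLinearMap.adjoint A = (rA : ℂ) • (1 : H →L[ℂ] H))
    (hφ : ‖φ‖ = 1) {F : ℂ → ℂ} (hF : Continuous F) :
    Tendsto (fun N => ∑ k, (Γ.xi N k : ℂ) ^ 2 * F (Γ.lam N k)) (Γ.D : Filter ℕ)
      (𝓝 (inner ℂ φ (cfc F A φ))) := by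
  have := isStarNormal_of_eq hA hA'
  have hnt : Nontrivial H := ⟨φ, 0, by rintro rfl; simp at hφ⟩
  rw [Metric.tendsto_nhds]
  intro δ hδ
  obtain ⟨P, hP⟩ := exists_polyFun_near (isCompact_closedBall (0 : ℂ) (Γ.M : ℝ)) hF
    (show 0 < δ / 3 by positivity)
  filter_upwards [Γ.eventually_sum_polyFun hr hA hA' P] with N hN
  have e1 : ‖∑ k, (Γ.xi N k : ℂ) ^ 2 * F (Γ.lam N k) -
      ∑ k, (Γ.xi N k : ℂ) ^ 2 * polyFun P (Γ.lam N k)‖ ≤ δ / 3 := by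
    rw [← Finset.sum_sub_distrib]
    calc _ ≤ ∑ k, Γ.xi N k ^ 2 * (δ / 3) := by
          refine norm_sum_le_of_le _ fun k _ => ?_
          rw [← mul_sub, norm_mul, norm_pow, Complex.norm_real, Real.norm_eq_abs, sq_abs]
          refine mul_le_mul_of_nonneg_left (hP _ ?_).le (sq_nonneg _)
          simpa using (Γ.norm_lam_lt hr.le hA N k).le
      _ = δ / 3 := by rw [← Finset.sum_mul, Γ.sum_xi_sq, hφ]; ring
  have e2 : ‖inner ℂ φ (polyOp A P φ) - inner ℂ φ (cfc F A φ)‖ ≤ δ / 3 := by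
    rw [← inner_sub_right, ← cfc_polyFun, ← sub_apply,
      ← cfc_sub _ _ A (continuous_polyFun P).continuousOn hF.continuousOn]
    refine (norm_inner_le_norm _ _).trans ?_
    rw [hφ, one_mul]
    refine (ContinuousLinearMap.le_opNorm _ _).trans ?_
    rw [hφ, mul_one]
    refine norm_cfc_le (by positivity) fun z hz => ?_
    rw [norm_sub_rev]
    refine (hP z ?_).le
    simpa using (spectrum.norm_le_norm_of_mem hz).trans Γ.norm_lt.le
  rw [dist_eq_norm]
  rw [hN] at e1
  calc _ ≤ _ := norm_sub_le_norm_sub_add_norm_sub _ (inner ℂ φ (polyOp A P φ)) _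
    _ < δ := by linarith

theorem muN_mono (N : ℕ) {X Y : Set ℂ} (h : X ⊆ Y) : Γ.muN N X ≤ Γ.muN N Y := by
  have h1 : Γ.muN N ∅ = 0 := by simp [muN]
  have := Setup.muN_le_add (Γ := Γ) N (X := Y) (Y := ∅) (Z := X) (by simpa using h)
  linarith

theorem muNaive_mono {X Y : Set ℂ} (h : X ⊆ Y) : Γ.muNaive X ≤ Γ.muNaive Y :=
  le_of_tendsto_of_tendsto' (Γ.tendsto_muN X) (Γ.tendsto_muN Y) fun N => Γ.muN_mono N h

theorem norm_sum_le_muN (N : ℕ) {X : Set ℂ} {F : ℂ → ℝ} (h0 : ∀ z, 0 ≤ F z) (h1 : ∀ z, F z ≤ 1)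
    (hX : ∀ z, z ∉ X → F z = 0) :
    ‖∑ k, (Γ.xi N k : ℂ) ^ 2 * (F (Γ.lam N k) : ℂ)‖ ≤ Γ.muN N X := by
  refine norm_sum_le_of_le _ fun k _ => ?_
  rw [norm_mul, norm_pow, Complex.norm_real, Complex.norm_real, Real.norm_eq_abs, sq_abs,
    Real.norm_of_nonneg (h0 _)]
  split_ifs with h
  · exact mul_le_of_le_one_right (sq_nonneg _) (h1 _)
  · simp [hX _ h]

theorem muN_le_norm_sum (N : ℕ) {X : Set ℂ} {F : ℂ → ℝ} (h0 : ∀ z, 0 ≤ F z)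
    (hX : ∀ z ∈ X, F z = 1) :
    Γ.muN N X ≤ ‖∑ k, (Γ.xi N k : ℂ) ^ 2 * (F (Γ.lam N k) : ℂ)‖ := by
  have : ∑ k, (Γ.xi N k : ℂ) ^ 2 * (F (Γ.lam N k) : ℂ) =
      ((∑ k, Γ.xi N k ^ 2 * F (Γ.lam N k) : ℝ) : ℂ) := by push_cast; rfl
  rw [this, Complex.norm_real]
  refine le_trans (Finset.sum_le_sum fun k _ => ?_) (le_abs_self _)
  split_ifs with h
  · rw [hX _ h, mul_one]
  · exact mul_nonneg (sq_nonneg _) (h0 _)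

/-- The approximate eigenvalues concentrate near the spectrum. -/
theorem tendsto_muN_compl_cthickening (hr : 0 < rA)
    (hA : ContinuousLinearMap.adjoint A * A = (rA : ℂ) • (1 : H →L[ℂ] H))
    (hA' : A * ContinuousLinearMap.adjoint A = (rA : ℂ) • (1 : H →L[ℂ] H))
    (hφ : ‖φ‖ = 1) {ε : ℝ} (hε : 0 < ε) :
    Tendsto (fun N => Γ.muN N (Metric.cthickening ε (spectrum ℂ A))ᶜ) (Γ.D : Filter ℕ) (𝓝 0) := by
  have := isStarNormal_of_eq hA hA'
  -- This cutoff vanishes on `σ(A)`, so `F(A) = 0`, and equals 1 off the thickening, so its sums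
  -- dominate `μ_N` there.
  set F : ℂ → ℝ := fun z => min 1 (Metric.infDist z (spectrum ℂ A) / ε) with hFdef
  have hFc : Continuous F :=
    continuous_const.min ((Metric.continuous_infDist_pt _).div_const _)
  have hlim := (Γ.tendsto_sum_cfc hr hA hA' hφ (F := fun z => (F z : ℂ))
    (Complex.continuous_ofReal.comp hFc)).norm
  have hz : cfc (fun z => (F z : ℂ)) A = 0 := by
    have heq : EqOn (fun z => (F z : ℂ)) (fun _ => 0) (spectrum ℂ A) := fun z hz => by
      simp [hFdef, Metric.infDist_zero_of_mem hz]
    rw [cfc_congr heq, cfc_const_zero]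
  have hne : (spectrum ℂ A).Nonempty := by
    have hnt : Nontrivial H := ⟨φ, 0, by rintro rfl; simp at hφ⟩
    exact spectrum.nonempty A
  rw [hz, _root_.zero_apply, inner_zero_right, norm_zero] at hlim
  have hF0 : ∀ z, 0 ≤ F z := fun z =>
    le_min zero_le_one (div_nonneg Metric.infDist_nonneg hε.le)
  have hF1 : ∀ z ∈ (Metric.cthickening ε (spectrum ℂ A))ᶜ, F z = 1 := by
    intro z hz
    refine min_eq_left ((one_le_div hε).2 ?_)
    by_contra hlt
    refine hz ((Metric.mem_cthickening_iff).2 ?_)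
    rw [ENNReal.le_ofReal_iff_toReal_le (Metric.infEDist_ne_top hne) hε.le]
    exact (not_le.1 hlt).le
  exact squeeze_zero (fun N => Setup.muN_nonneg N _)
    (fun N => Γ.muN_le_norm_sum N hF0 hF1) hlim

/-- Neighbourhoods of spectral points have positive naive measure. -/
theorem muNaive_closedBall_pos (hr : 0 < rA)
    (hA : ContinuousLinearMap.adjoint A * A = (rA : ℂ) • (1 : H →L[ℂ] H))
    (hA' : A * ContinuousLinearMap.adjoint A = (rA : ℂ) • (1 : H →L[ℂ] H))
    (hφ : ‖φ‖ = 1) (hcyc : IsCyclic A φ) {α : ℂ} (hα : α ∈ spectrum ℂ A) {ε : ℝ} (hε : 0 < ε) :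
    0 < Γ.muNaive (Metric.closedBall α ε) := by
  have := isStarNormal_of_eq hA hA'
  -- A tent with value 1 at `α`, supported in the ball. Its square is used below because `⟨φ | F²(A)
  -- φ⟩ = ‖F(A) φ‖²`.
  set F : ℂ → ℝ := fun z => max 0 (1 - dist z α / ε) with hFdef
  have hFc : Continuous F := by fun_prop
  have h0 : ∀ z, 0 ≤ F z := fun z => le_max_left _ _
  have h1 : ∀ z, F z ≤ 1 := fun z =>
    max_le zero_le_one (sub_le_self _ (div_nonneg dist_nonneg hε.le))
  have hX : ∀ z, z ∉ Metric.closedBall α ε → F z = 0 := by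
    intro z hz
    rw [Metric.mem_closedBall, not_le] at hz
    exact max_eq_left (sub_nonpos.2 ((one_le_div hε).2 hz.le))
  have hGc : Continuous fun z => (F z : ℂ) := Complex.continuous_ofReal.comp hFc
  have hlim := (Γ.tendsto_sum_cfc hr hA hA' hφ (F := fun z => ((F z ^ 2 : ℝ) : ℂ))
    (Complex.continuous_ofReal.comp (hFc.pow 2))).norm
  have hle := le_of_tendsto_of_tendsto' hlim (Γ.tendsto_muN (Metric.closedBall α ε)) fun N =>
    Γ.norm_sum_le_muN N (F := fun z => F z ^ 2) (fun z => sq_nonneg _)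
      (fun z => pow_le_one₀ (h0 z) (h1 z)) (fun z hz => by simp [hX z hz])
  refine lt_of_lt_of_le ?_ hle
  set T := cfc (fun z => (F z : ℂ)) A with hT
  have hsa : ContinuousLinearMap.adjoint T = T := by
    rw [← ContinuousLinearMap.star_eq_adjoint, hT, ← cfc_star]
    simp
  have hsq : cfc (fun z => ((F z ^ 2 : ℝ) : ℂ)) A = T * T := by
    rw [hT, ← cfc_mul _ _ A hGc.continuousOn hGc.continuousOn]
    congr 1; ext z; push_cast; ring
  have hin : inner ℂ φ ((T * T) φ) = ((‖T φ‖ ^ 2 : ℝ) : ℂ) := by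
    rw [mul_apply_eq_comp]
    nth_rewrite 1 [← hsa]
    rw [ContinuousLinearMap.adjoint_inner_right, inner_self_eq_norm_sq_to_K]
    push_cast; rfl
  rw [hsq, hin, Complex.norm_real, Real.norm_of_nonneg (sq_nonneg _)]
  refine pow_pos (norm_pos_iff.2 fun hTφ => ?_) 2
  -- `F(A)` commutes with every `P(A, A*)`, so `F(A) φ = 0` would spread to the dense set of the
  -- `P(A, A*) φ`. This contradicts `F(α) = 1`.
  have hT0 : T = 0 := by
    refine ContinuousLinearMap.ext fun x => ?_
    refine congrFun (Continuous.ext_on hcyc T.continuous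
      (0 : H →L[ℂ] H).continuous ?_) x
    rintro _ ⟨P, rfl⟩
    have hcomm : T * polyOp A P = polyOp A P * T := by
      rw [← cfc_polyFun, hT]
      exact (cfc_commute_cfc _ _ A).eq
    have := congrArg (fun S : H →L[ℂ] H => S φ) hcomm
    simpa [hTφ] using this
  have heq : EqOn (fun z => (F z : ℂ)) (fun _ => (0 : ℂ)) (spectrum ℂ A) :=
    eqOn_of_cfc_eq_cfc (a := A) (by rw [cfc_const_zero]; exact hT0) hGc.continuousOn
      continuousOn_const
  simpa [hFdef] using heq hα

end Setup
end SpectralLimit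

/-! ### Comparison of `μ` with the naive measure. -/

section SpectralMeasure

variable {H : Type*} [NormedAddCommGroup H] [InnerProductSpace ℂ H] [CompleteSpace H]
  {A : H →L[ℂ] H} {rA : ℝ} {φ : H}

theorem Setup.rect_eq_reProdIm (Γ : Setup A rA φ) {r₀ r₁ r₂ r₃ : ℝ}
    (h₀ : -(Γ.M : ℝ) ≤ r₀) (h₁ : r₁ ≤ Γ.M) (h₂ : -(Γ.M : ℝ) ≤ r₂) (h₃ : r₃ ≤ Γ.M) :
    Γ.rect r₀ r₁ r₂ r₃ = Ioo r₀ r₁ ×ℂ Ioo r₂ r₃ := by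
  ext z
  simp only [rect, mem_ofPred_eq, Complex.mem_reProdIm, mem_Ioo, S]
  refine ⟨fun h => h.2, fun h => ⟨⟨⟨?_, ?_⟩, ?_, ?_⟩, h⟩⟩ <;> linarith [h.1.1, h.1.2, h.2.1, h.2.2]

theorem Setup.isOpen_rect (Γ : Setup A rA φ) {r₀ r₁ r₂ r₃ : ℝ}
    (h₀ : -(Γ.M : ℝ) ≤ r₀) (h₁ : r₁ ≤ Γ.M) (h₂ : -(Γ.M : ℝ) ≤ r₂) (h₃ : r₃ ≤ Γ.M) :
    IsOpen (Γ.rect r₀ r₁ r₂ r₃) := by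
  rw [Γ.rect_eq_reProdIm h₀ h₁ h₂ h₃]
  exact isOpen_Ioo.reProdIm isOpen_Ioo

theorem Setup.rect_subset_interior (Γ : Setup A rA φ) {r₀ r₁ r₂ r₃ : ℝ}
    (h₀ : -(Γ.M : ℝ) ≤ r₀) (h₁ : r₁ ≤ Γ.M) (h₂ : -(Γ.M : ℝ) ≤ r₂) (h₃ : r₃ ≤ Γ.M) :
    Γ.rect r₀ r₁ r₂ r₃ ⊆ interior Γ.S :=
  interior_maximal (fun _ hz => hz.1) (Γ.isOpen_rect h₀ h₁ h₂ h₃)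

theorem Setup.muNaive_biUnion_le (Γ : Setup A rA φ) (F : Finset ℕ) (t : ℕ → Set ℂ) :
    Γ.muNaive (⋃ i ∈ F, t i) ≤ ∑ i ∈ F, Γ.muNaive (t i) := by
  induction F using Finset.induction_on with
  | empty =>
    refine le_of_tendsto' (Γ.tendsto_muN _) fun N => ?_
    simp [muN]
  | insert a F ha ih =>
    rw [Finset.sum_insert ha]
    exact (Setup.muNaive_le_add (by simp)).trans (add_le_add_right ih _)

variable {Γ : Setup A rA φ} (ν : NiceSet Γ)

theorem NiceSet.isOpen_of_mem {X : Set ℂ} (hX : X ∈ ν.SqStar) : IsOpen X := by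
  obtain ⟨r₀, h₀, r₁, h₁, r₂, h₂, r₃, h₃, rfl⟩ := hX
  exact Γ.isOpen_rect (ν.nice _ h₀).1.1 (ν.nice _ h₁).1.2 (ν.nice _ h₂).1.1 (ν.nice _ h₃).1.2

theorem NiceSet.mu_apply {X : Set ℂ} (hX : MeasurableSet X) :
    ν.mu X = OuterMeasure.boundedBy ν.preMeasure (X ∩ interior Γ.S) := by
  rw [NiceSet.mu, toMeasure_apply _ _ hX, NiceSet.outer, OuterMeasure.restrict_apply]

/-- The naive measure is only finitely subadditive; compactness cuts a countable open cover down to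
a finite one. -/
theorem NiceSet.muNaive_le_mu {C X : Set ℂ} (hC : IsCompact C) (hCS : C ⊆ interior Γ.S)
    (hX : MeasurableSet X) (hCX : C ⊆ X) : ENNReal.ofReal (Γ.muNaive C) ≤ ν.mu X := by
  rw [ν.mu_apply hX, OuterMeasure.boundedBy_apply]
  refine le_iInf fun t => le_iInf fun ht => ?_
  -- A nonempty covering set outside `Sq*` costs `∞`, so only covers by open rectangles matter.
  by_cases hbad : ∃ n, (t n).Nonempty ∧ t n ∉ ν.SqStar
  · obtain ⟨n, hn, hn'⟩ := hbad
    refine le_trans ?_ (ENNReal.le_tsum n)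
    simp [hn, NiceSet.preMeasure, hn']
  push Not at hbad
  have hopen : ∀ n, IsOpen (t n) := fun n => by
    rcases (t n).eq_empty_or_nonempty with h | h
    · rw [h]; exact isOpen_empty
    · exact ν.isOpen_of_mem (hbad n h)
  obtain ⟨F, hF⟩ := hC.elim_finite_subcover t hopen
    ((subset_inter hCX hCS).trans ht)
  refine (ENNReal.ofReal_le_ofReal ((Γ.muNaive_mono hF).trans (Γ.muNaive_biUnion_le F t))).trans ?_
  rw [ENNReal.ofReal_sum_of_nonneg fun i _ => Setup.muNaive_nonneg _]
  refine le_trans (Finset.sum_le_sum fun i _ => ?_) (ENNReal.sum_le_tsum F)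
  rcases (t i).eq_empty_or_nonempty with h | h
  -- The empty union yields `μⁿ(∅) ≤ 0`.
  · have := Γ.muNaive_biUnion_le ∅ t
    simp only [Finset.notMem_empty, iUnion_of_empty, iUnion_empty, Finset.sum_empty] at this
    simp [h, this]
  · simp [h, NiceSet.preMeasure]

theorem NiceSet.exists_mem_Ioo {a b : ℝ} (hab : a < b) (ha : -(Γ.M : ℝ) ≤ a) (hb : b ≤ Γ.M) :
    ∃ s ∈ ν.NI, a < s ∧ s < b := by
  obtain ⟨x, hx⟩ := _root_.exists_between hab
  obtain ⟨s, hs, hsN⟩ := mem_closure_iff.1 (ν.dense ⟨ha.trans hx.1.le, hx.2.le.trans hb⟩)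
    (Ioo a b) isOpen_Ioo hx
  exact ⟨s, hsN, hs⟩

/-- The sides need not lie in `NI`, but the rectangle is a countable directed union of members of
`Sq*`, and `μ` is continuous along such unions. -/
theorem NiceSet.mu_rect_le {r₀ r₁ r₂ r₃ : ℝ}
    (h₀ : -(Γ.M : ℝ) ≤ r₀) (h₁ : r₁ ≤ Γ.M) (h₂ : -(Γ.M : ℝ) ≤ r₂) (h₃ : r₃ ≤ Γ.M) :
    ν.mu (Γ.rect r₀ r₁ r₂ r₃) ≤ ENNReal.ofReal (Γ.muNaive (Γ.rect r₀ r₁ r₂ r₃)) := by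
  let ι := {p : (ν.NI × ν.NI) × (ν.NI × ν.NI) //
    (r₀ ≤ p.1.1 ∧ p.1.2 ≤ r₁) ∧ (r₂ ≤ p.2.1 ∧ p.2.2 ≤ r₃)}
  have : Countable ν.NI := ν.countable.to_subtype
  let X : ι → Set ℂ := fun p => Γ.rect p.1.1.1 p.1.1.2 p.1.2.1 p.1.2.2
  have hsub : ∀ p : ι, X p ⊆ Γ.rect r₀ r₁ r₂ r₃ := fun p z hz =>
    ⟨hz.1, ⟨p.2.1.1.trans_lt hz.2.1.1, hz.2.1.2.trans_le p.2.1.2⟩,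
      p.2.2.1.trans_lt hz.2.2.1, hz.2.2.2.trans_le p.2.2.2⟩
  have hU : Γ.rect r₀ r₁ r₂ r₃ = ⋃ p, X p := by
    refine Subset.antisymm (fun z hz => ?_) (iUnion_subset hsub)
    obtain ⟨s₀, hs₀, l₀, u₀⟩ := ν.exists_mem_Ioo hz.2.1.1 h₀ hz.1.1.2
    obtain ⟨s₁, hs₁, l₁, u₁⟩ := ν.exists_mem_Ioo hz.2.1.2 hz.1.1.1 h₁
    obtain ⟨s₂, hs₂, l₂, u₂⟩ := ν.exists_mem_Ioo hz.2.2.1 h₂ hz.1.2.2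
    obtain ⟨s₃, hs₃, l₃, u₃⟩ := ν.exists_mem_Ioo hz.2.2.2 hz.1.2.1 h₃
    exact mem_iUnion.2 ⟨⟨((⟨s₀, hs₀⟩, ⟨s₁, hs₁⟩), (⟨s₂, hs₂⟩, ⟨s₃, hs₃⟩)),
      ⟨l₀.le, u₁.le⟩, l₂.le, u₃.le⟩, hz.1, ⟨u₀, l₁⟩, u₂, l₃⟩
  have hdir : Directed (· ⊆ ·) X := fun p q =>
    ⟨⟨((⟨_, ν.min_mem p.1.1.1.2 q.1.1.1.2⟩, ⟨_, ν.max_mem p.1.1.2.2 q.1.1.2.2⟩),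
        (⟨_, ν.min_mem p.1.2.1.2 q.1.2.1.2⟩, ⟨_, ν.max_mem p.1.2.2.2 q.1.2.2.2⟩)),
      ⟨le_min p.2.1.1 q.2.1.1, max_le p.2.1.2 q.2.1.2⟩,
      le_min p.2.2.1 q.2.2.1, max_le p.2.2.2 q.2.2.2⟩,
      fun z hz => ⟨hz.1, ⟨(min_le_left _ _).trans_lt hz.2.1.1, hz.2.1.2.trans_le (le_max_left _ _)⟩,
        (min_le_left _ _).trans_lt hz.2.2.1, hz.2.2.2.trans_le (le_max_left _ _)⟩,
      fun z hz => ⟨hz.1, ⟨(min_le_right _ _).trans_lt hz.2.1.1,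
        hz.2.1.2.trans_le (le_max_right _ _)⟩,
        (min_le_right _ _).trans_lt hz.2.2.1, hz.2.2.2.trans_le (le_max_right _ _)⟩⟩
  conv_lhs => rw [hU, hdir.measure_iUnion]
  refine iSup_le fun p => ?_
  have hp : X p ∈ ν.SqStar :=
    ⟨_, p.1.1.1.2, _, p.1.1.2.2, _, p.1.2.1.2, _, p.1.2.2.2, rfl⟩
  rw [ν.mu_apply (ν.isOpen_of_mem hp).measurableSet]
  exact (ν.boundedBy_le hp inter_subset_left).trans
    (ENNReal.ofReal_le_ofReal (Γ.muNaive_mono (hsub p)))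

/-! ### The grid, its boxes, and the vectors `u(θ)` for Dirac deltas. -/

namespace Grid

variable {α β : ℂ} (g : Grid Γ α β)

theorem left_mem {n i : ℕ} (hi : i < 2 ^ (n + 2)) : -(Γ.M : ℝ) ≤ g.r n i :=
  (g.mem n i (by omega)).1

theorem right_mem {n i : ℕ} (hi : i < 2 ^ (n + 2)) : g.r n (i + 1) ≤ Γ.M :=
  (g.mem n (i + 1) (by omega)).2

theorem isOpen_box {n i j : ℕ} (hi : i < 2 ^ (n + 2)) (hj : j < 2 ^ (n + 2)) :
    IsOpen (g.box n i j) :=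
  Γ.isOpen_rect (g.left_mem hi) (g.right_mem hi) (g.left_mem hj) (g.right_mem hj)

theorem box_subset_interior {n i j : ℕ} (hi : i < 2 ^ (n + 2)) (hj : j < 2 ^ (n + 2)) :
    g.box n i j ⊆ interior Γ.S :=
  Γ.rect_subset_interior (g.left_mem hi) (g.right_mem hi) (g.left_mem hj) (g.right_mem hj)

/-- For the lower bound the box is covered by a compact core, to which `muNaive_le_mu` applies, and
by `R^n_ε`, whose naive measure is below `δ`. -/
theorem mu_box {n i j : ℕ} (hi : i < 2 ^ (n + 2)) (hj : j < 2 ^ (n + 2)) :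
    ν.mu (g.box n i j) = ENNReal.ofReal (Γ.muNaive (g.box n i j)) := by
  refine le_antisymm
    (ν.mu_rect_le (g.left_mem hi) (g.right_mem hi) (g.left_mem hj) (g.right_mem hj)) ?_
  refine ENNReal.le_of_forall_pos_le_add fun δ hδ _ => ?_
  obtain ⟨ε, hε, hR⟩ := g.thin n δ (by exact_mod_cast hδ)
  set C : Set ℂ := Icc (g.r n i + ε / 2) (g.r n (i + 1) - ε / 2) ×ℂ
    Icc (g.r n j + ε / 2) (g.r n (j + 1) - ε / 2) with hCdef
  have hCc : IsCompact C := isCompact_Icc.reProdIm isCompact_Icc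
  have hCb : C ⊆ g.box n i j := by
    rw [box, Γ.rect_eq_reProdIm (g.left_mem hi) (g.right_mem hi) (g.left_mem hj) (g.right_mem hj)]
    intro z hz
    rw [hCdef, Complex.mem_reProdIm] at hz
    exact ⟨⟨by linarith [hz.1.1], by linarith [hz.1.2]⟩,
      by linarith [hz.2.1], by linarith [hz.2.2]⟩
  have hsub : g.box n i j ⊆ C ∪
      {z | ∃ i < 2 ^ (n + 2) + 1, z ∈ Γ.stripI (g.r n i) ε ∪ Γ.stripJ (g.r n i) ε} := by
    intro z hz
    by_contra hcon
    simp only [mem_union, not_or, mem_ofPred_eq, not_exists, not_and, Setup.stripI,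
      Setup.stripJ, not_lt] at hcon
    obtain ⟨hzC, hzR⟩ := hcon
    have a1 := (hzR i (by omega)).1 hz.1
    have a2 := (hzR (i + 1) (by omega)).1 hz.1
    have a3 := (hzR j (by omega)).2 hz.1
    have a4 := (hzR (j + 1) (by omega)).2 hz.1
    obtain ⟨b1, b2⟩ := hz.2.1
    obtain ⟨b3, b4⟩ := hz.2.2
    rw [abs_of_pos (by linarith)] at a1 a3
    rw [abs_of_neg (by linarith)] at a2 a4
    refine hzC ?_
    rw [hCdef, Complex.mem_reProdIm]
    exact ⟨⟨by linarith, by linarith⟩, by linarith, by linarith⟩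
  have h1 : Γ.muNaive (g.box n i j) ≤ Γ.muNaive C + δ :=
    (Setup.muNaive_le_add hsub).trans (by linarith)
  refine (ENNReal.ofReal_le_ofReal h1).trans ?_
  rw [ENNReal.ofReal_add (Setup.muNaive_nonneg _) δ.coe_nonneg, ENNReal.ofReal_coe_nnreal]
  exact add_le_add_left (ν.muNaive_le_mu hCc (hCb.trans (g.box_subset_interior hi hj))
    (g.isOpen_box hi hj).measurableSet hCb) _

theorem muNaive_box_pos (hr : 0 < rA)
    (hA : ContinuousLinearMap.adjoint A * A = (rA : ℂ) • (1 : H →L[ℂ] H))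
    (hA' : A * ContinuousLinearMap.adjoint A = (rA : ℂ) • (1 : H →L[ℂ] H))
    (hφ : ‖φ‖ = 1) (hcyc : IsCyclic A φ) {z : ℂ} (hz : z ∈ spectrum ℂ A)
    {n i j : ℕ} (hi : i < 2 ^ (n + 2)) (hj : j < 2 ^ (n + 2)) (hzb : z ∈ g.box n i j) :
    0 < Γ.muNaive (g.box n i j) := by
  obtain ⟨ε, hε, hb⟩ := Metric.nhds_basis_closedBall.mem_iff.1 ((g.isOpen_box hi hj).mem_nhds hzb)
  exact (Γ.muNaive_closedBall_pos hr hA hA' hφ hcyc hz hε).trans_le (Γ.muNaive_mono hb)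

theorem strictMono_r {n i j : ℕ} (hij : i < j) (hj : j ≤ 2 ^ (n + 2)) : g.r n i < g.r n j := by
  induction j, hij using Nat.le_induction with
  | base => exact (g.step n i (by omega)).1
  | succ j hij ih => exact (ih (by omega)).trans (g.step n j (by omega)).1

theorem mono_r {n i j : ℕ} (hij : i ≤ j) (hj : j ≤ 2 ^ (n + 2)) : g.r n i ≤ g.r n j := by
  rcases hij.eq_or_lt with rfl | h
  · exact le_rfl
  · exact (g.strictMono_r h hj).le

/-- Points of one level reappear at the next, so the endpoint `-M` of level 0 persists, and no grid
point lies below it. -/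
theorem r_zero (n : ℕ) : g.r n 0 = -(Γ.M : ℝ) := by
  induction n with
  | zero => exact g.left
  | succ n ih =>
    obtain ⟨j, hj, h⟩ := g.refines n 0 (by positivity)
    have h1 : g.r (n + 1) 0 ≤ g.r (n + 1) j := g.mono_r (Nat.zero_le _) (Nat.le_of_lt_succ hj)
    exact le_antisymm (by linarith) (g.mem (n + 1) 0 (by positivity)).1

theorem r_last (n : ℕ) : g.r n (2 ^ (n + 2)) = Γ.M := by
  induction n with
  | zero => exact g.right
  | succ n ih =>
    obtain ⟨j, hj, h⟩ := g.refines n (2 ^ (n + 2)) (by omega)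
    have h1 : g.r (n + 1) j ≤ g.r (n + 1) (2 ^ (n + 1 + 2)) :=
      g.mono_r (Nat.le_of_lt_succ hj) le_rfl
    exact le_antisymm (g.mem (n + 1) _ (by omega)).2 (by linarith)

theorem exists_index {n : ℕ} {x : ℝ} (hx : x ∈ Icc (-(Γ.M : ℝ)) Γ.M)
    (hne : ∀ i < 2 ^ (n + 2) + 1, g.r n i ≠ x) :
    ∃ i < 2 ^ (n + 2), g.r n i < x ∧ x < g.r n (i + 1) := by
  have hex : ∃ i, i ≤ 2 ^ (n + 2) ∧ x < g.r n i :=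
    ⟨_, le_rfl, lt_of_le_of_ne ((g.r_last n).symm ▸ hx.2) (hne _ (by omega)).symm⟩
  obtain ⟨h1, h2⟩ := Nat.find_spec hex
  have h0 : Nat.find hex ≠ 0 := by
    intro h0
    rw [h0, g.r_zero] at h2
    exact (hx.1.trans_lt h2).false
  obtain ⟨i, hi⟩ := Nat.exists_eq_succ_of_ne_zero h0
  have h3 := Nat.find_min hex (m := i) (by omega)
  rw [hi] at h1 h2
  refine ⟨i, by omega, lt_of_le_of_ne ?_ (hne i (by omega)), h2⟩
  by_contra hlt
  exact h3 ⟨by omega, not_le.1 hlt⟩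

theorem exists_box {n : ℕ} {z : ℂ} (hz : z ∈ Γ.S)
    (hne : ∀ i < 2 ^ (n + 2) + 1, g.r n i ≠ z.re ∧ g.r n i ≠ z.im) :
    ∃ i < 2 ^ (n + 2), ∃ j < 2 ^ (n + 2), z ∈ g.box n i j := by
  obtain ⟨i, hi, h1⟩ := g.exists_index hz.1 fun i hi => (hne i hi).1
  obtain ⟨j, hj, h2⟩ := g.exists_index hz.2 fun i hi => (hne i hi).2
  exact ⟨i, hi, j, hj, hz, h1, h2⟩

theorem index_unique {n i i' : ℕ} {x : ℝ} (hi : i < 2 ^ (n + 2)) (hi' : i' < 2 ^ (n + 2))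
    (h : g.r n i < x ∧ x < g.r n (i + 1)) (h' : g.r n i' < x ∧ x < g.r n (i' + 1)) : i = i' := by
  rcases lt_trichotomy i i' with hlt | he | hlt
  · have : g.r n (i + 1) ≤ g.r n i' := g.mono_r hlt hi'.le
    linarith [h.2, h'.1]
  · exact he
  · have : g.r n (i' + 1) ≤ g.r n i := g.mono_r hlt hi.le
    linarith [h.1, h'.2]

theorem boxAt_eq {n i j : ℕ} {z : ℂ} (hi : i < 2 ^ (n + 2)) (hj : j < 2 ^ (n + 2))
    (hz : z ∈ g.box n i j) : g.boxAt n z = g.box n i j := by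
  ext w
  refine ⟨?_, fun hw => ⟨i, hi, j, hj, hz, hw⟩⟩
  rintro ⟨i', hi', j', hj', hz', hw⟩
  rwa [g.index_unique hi hi' hz.2.1 hz'.2.1, g.index_unique hj hj' hz.2.2 hz'.2.2]

theorem dist_lt_of_mem_box {n i j : ℕ} {z w : ℂ} (hi : i < 2 ^ (n + 2)) (hj : j < 2 ^ (n + 2))
    (hz : z ∈ g.box n i j) (hw : w ∈ g.box n i j) : dist z w < 4 * Γ.M / (n + 1) := by
  have s1 := (g.step n i hi).2
  have s2 := (g.step n j hj).2
  have h1 : |(z - w).re| < 2 * Γ.M / (n + 1) := by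
    rw [Complex.sub_re, abs_lt]
    constructor <;> linarith [hz.2.1.1, hz.2.1.2, hw.2.1.1, hw.2.1.2]
  have h2 : |(z - w).im| < 2 * Γ.M / (n + 1) := by
    rw [Complex.sub_im, abs_lt]
    constructor <;> linarith [hz.2.2.1, hz.2.2.2, hw.2.2.1, hw.2.2.2]
  have h3 := Complex.norm_le_abs_re_add_abs_im (z - w)
  have h4 : (4 * Γ.M / (n + 1) : ℝ) = 2 * Γ.M / (n + 1) + 2 * Γ.M / (n + 1) := by ring
  rw [dist_eq_norm, h4]
  linarith

/-- A product of four linear ramps, one per side. Nonemptiness makes the filter in `boxValue`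
proper, without which its limit would carry no information. -/
theorem plateau_nonempty (n i j : ℕ) {ε : ℝ} (hε : 0 < ε) : (g.plateau n i j ε).Nonempty := by
  let c : ℝ → ℝ := fun t => max 0 (min 1 (t / ε))
  have hc : Continuous c := by fun_prop
  have hc0 : ∀ t, 0 ≤ c t := fun t => le_max_left _ _
  have hc1 : ∀ t, c t ≤ 1 := fun t => max_le zero_le_one (min_le_left _ _)
  have hcn : ∀ t ≤ 0, c t = 0 := fun t ht =>
    max_eq_left ((min_le_right _ _).trans (div_nonpos_of_nonpos_of_nonneg ht hε.le))
  have hcp : ∀ t, ε < t → c t = 1 := fun t ht => by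
    have : min 1 (t / ε) = 1 := min_eq_left ((one_le_div hε).2 ht.le)
    simp [c, this]
  let f : ℂ → ℝ := fun z => (c (z.re - g.r n i) * c (g.r n (i + 1) - z.re)) *
    (c (z.im - g.r n j) * c (g.r n (j + 1) - z.im))
  have hf : Continuous f := by
    have := hc.comp (Complex.continuous_re.sub (continuous_const (y := g.r n i)))
    have := hc.comp ((continuous_const (y := g.r n (i + 1))).sub Complex.continuous_re)
    have := hc.comp (Complex.continuous_im.sub (continuous_const (y := g.r n j)))
    have := hc.comp ((continuous_const (y := g.r n (j + 1))).sub Complex.continuous_im)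
    simp only [Function.comp_def] at *
    fun_prop
  refine ⟨⟨fun z => (f z : ℂ),
    (Complex.continuous_ofReal.comp hf).comp continuous_subtype_val⟩, fun z => ⟨?_, ?_⟩, ?_⟩
  · simp only [ContinuousMap.coe_mk, Complex.norm_real, f]
    rw [Real.norm_of_nonneg (by have := hc0; positivity)]
    exact mul_le_one₀ (mul_le_one₀ (hc1 _) (hc0 _) (hc1 _)) (mul_nonneg (hc0 _) (hc0 _))
      (mul_le_one₀ (hc1 _) (hc0 _) (hc1 _))
  · intro hz
    have hz' : z.1.re - g.r n i ≤ 0 ∨ g.r n (i + 1) - z.1.re ≤ 0 ∨ z.1.im - g.r n j ≤ 0 ∨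
        g.r n (j + 1) - z.1.im ≤ 0 := by
      by_contra! hcon
      exact hz ⟨z.2, ⟨by linarith, by linarith⟩, by linarith, by linarith⟩
    simp only [ContinuousMap.coe_mk, f]
    rcases hz' with h | h | h | h <;> simp [hcn _ h]
  · rintro z ⟨h1, h2⟩ ⟨h3, h4⟩
    simp only [ContinuousMap.coe_mk, f]
    rw [hcp _ (by linarith), hcp _ (by linarith), hcp _ (by linarith), hcp _ (by linarith)]
    simp

theorem plateau_mono (n i j : ℕ) : Monotone (g.plateau n i j) := by
  rintro a b hab f ⟨h1, h2⟩
  exact ⟨h1, fun z hz hz' => h2 z ⟨by linarith [hz.1], by linarith [hz.2]⟩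
    ⟨by linarith [hz'.1], by linarith [hz'.2]⟩⟩

theorem boxValue_eq {θ : GenDist Γ} {n i j : ℕ} {q : ℂ} {ε : ℝ} (hε : 0 < ε)
    (h : ∀ f ∈ g.plateau n i j ε, θ.toMap f = q) : g.boxValue θ n i j = q := by
  have hb : (⨅ ε ∈ Ioi (0 : ℝ), 𝓟 (g.plateau n i j ε)).HasBasis (fun ε => ε ∈ Ioi (0 : ℝ))
      (g.plateau n i j) := by
    refine hasBasis_biInf_principal ?_ ⟨1, mem_Ioi.2 one_pos⟩
    intro a ha b hb
    exact ⟨min a b, mem_Ioi.2 (lt_min ha hb), g.plateau_mono n i j (min_le_left _ _),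
      g.plateau_mono n i j (min_le_right _ _)⟩
  have : (⨅ ε ∈ Ioi (0 : ℝ), 𝓟 (g.plateau n i j ε)).NeBot :=
    hb.neBot_iff.2 fun hε => g.plateau_nonempty n i j hε
  refine Tendsto.limUnder_eq (tendsto_const_nhds.congr' ?_)
  filter_upwards [hb.mem_of_mem hε] with f hf
  exact (h f hf).symm

theorem boxValue_dirac_of_mem {a : spectrum ℂ A} {n i j : ℕ} (h : (a : ℂ) ∈ g.box n i j) :
    g.boxValue (Γ.dirac a) n i j = 1 := by
  obtain ⟨-, ⟨h1, h2⟩, h3, h4⟩ := h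
  -- With `ε` below the distances from the point to the four sides, every plateau function is 1 at
  -- the point.
  obtain ⟨ε, hε, hlt⟩ := _root_.exists_between (show (0 : ℝ) <
    min (min ((a : ℂ).re - g.r n i) (g.r n (i + 1) - (a : ℂ).re))
      (min ((a : ℂ).im - g.r n j) (g.r n (j + 1) - (a : ℂ).im)) by
    simp only [lt_min_iff]; exact ⟨⟨by linarith, by linarith⟩, by linarith, by linarith⟩)
  simp only [lt_min_iff] at hlt
  refine g.boxValue_eq hε fun f hf => ?_
  change (starRingEnd ℂ) (f ⟨a, _⟩) = 1
  rw [hf.2 _ ⟨by linarith [hlt.1.1], by linarith [hlt.1.2]⟩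
    ⟨by linarith [hlt.2.1], by linarith [hlt.2.2]⟩, map_one]

theorem boxValue_dirac_of_notMem {a : spectrum ℂ A} {n i j : ℕ} (h : (a : ℂ) ∉ g.box n i j) :
    g.boxValue (Γ.dirac a) n i j = 0 := by
  refine g.boxValue_eq one_pos fun f hf => ?_
  change (starRingEnd ℂ) (f ⟨a, _⟩) = 0
  rw [(hf.1 _).2 h, map_zero]

/-- Only the box containing the point has a nonzero `boxValue`, namely 1; positivity of its measure
keeps it in the sum. -/
theorem uVec_dirac {a : spectrum ℂ A} (n : ℕ → ℕ) {N i j : ℕ} (hi : i < 2 ^ (n N + 2))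
    (hj : j < 2 ^ (n N + 2)) (ha : (a : ℂ) ∈ g.box (n N) i j)
    (hpos : 0 < Γ.muNaive (g.box (n N) i j)) :
    g.uVec ν (Γ.dirac a) n N = Γ.avgVec (g.box (n N) i j) N := by
  have hne : ∀ i' < 2 ^ (n N + 2), ∀ j' < 2 ^ (n N + 2), (i' ≠ i ∨ j' ≠ j) →
      (a : ℂ) ∉ g.box (n N) i' j' := by
    rintro i' hi' j' hj' h ha'
    exact h.elim (· (g.index_unique hi' hi ha'.2.1 ha.2.1))
      (· (g.index_unique hj' hj ha'.2.2 ha.2.2))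
  rw [uVec, Finset.sum_eq_single_of_mem i (Finset.mem_range.2 hi),
    Finset.sum_eq_single_of_mem j (Finset.mem_range.2 hj), if_pos, Setup.avgVec]
  · simp only [g.boxValue_dirac_of_mem ha, mul_one]
  · rw [g.mu_box ν hi hj]
    simpa using hpos
  · intro j' hj' h
    simp [g.boxValue_dirac_of_notMem (hne i hi j' (Finset.mem_range.1 hj') (Or.inr h))]
  · intro i' hi' h
    refine Finset.sum_eq_zero fun j' hj' => ?_
    simp [g.boxValue_dirac_of_notMem
      (hne i' (Finset.mem_range.1 hi') j' (Finset.mem_range.1 hj') (Or.inl h))]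

end Grid
end SpectralMeasure

/-! ### The norms `‖·‖_0` and `‖·‖_∞`, their duality, and pairings of averages. -/

section Norms

variable {H : Type*} [NormedAddCommGroup H] [InnerProductSpace ℂ H] [CompleteSpace H]
  {A : H →L[ℂ] H} {rA : ℝ} {φ : H}

namespace Setup

variable (Γ : Setup A rA φ)

theorem coef_add (N : ℕ) (v w : HN A φ N) (k) :
    Γ.coef N (v + w) k = Γ.coef N v k + Γ.coef N w k := by
  simp [coef]

theorem coef_sum_smul (N : ℕ) (c : Fin (Module.finrank ℂ (HN A φ N)) → ℂ) (k) :
    Γ.coef N (∑ l, c l • Γ.u N l) k = c k := by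
  rw [coef_eq_inner, inner_sum]
  simp [inner_smul_right, OrthonormalBasis.inner_eq_ite]

theorem coef_avgVec (X : Set ℂ) (N : ℕ) (k) :
    Γ.coef N (Γ.avgVec X N) k =
      if Γ.lam N k ∈ X then (Γ.xi N k : ℂ) / (Γ.muN N X : ℂ) else 0 := by
  rw [← Γ.coef_sum_smul N (fun k => if Γ.lam N k ∈ X then (Γ.xi N k : ℂ) / (Γ.muN N X : ℂ) else 0) k]
  simp only [avgVec, ite_smul, zero_smul]

theorem coef_F (f : ℂ → ℂ) (N : ℕ) (k) :
    Γ.coef N (Γ.F f N) k = Γ.xi N k * f (Γ.lam N k) :=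
  Γ.coef_sum_smul N _ k

theorem inner_eq_sum (N : ℕ) (v w : HN A φ N) :
    inner ℂ v w = ∑ k, (starRingEnd ℂ) (Γ.coef N v k) * Γ.coef N w k := by
  rw [← (Γ.u N).sum_inner_mul_inner v w]
  simp only [coef_eq_inner, inner_conj_symm]

theorem xi_mul_norm_coef_avgVec (X : Set ℂ) (N : ℕ) (k) :
    Γ.xi N k * ‖Γ.coef N (Γ.avgVec X N) k‖ =
      (if Γ.lam N k ∈ X then Γ.xi N k ^ 2 else 0) / Γ.muN N X := by
  rw [coef_avgVec]
  split_ifs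
  · rw [norm_div, Complex.norm_real, Complex.norm_real, Real.norm_of_nonneg (Γ.xi_nonneg N k),
      Real.norm_of_nonneg (Setup.muN_nonneg N X)]
    ring
  · simp

/-- The sum is `μ_N(X) / μ_N(X)`, which is 0 rather than 1 when `μ_N(X) = 0`. -/
theorem norm0_avgVec_le_one (X : Set ℂ) (N : ℕ) : Γ.norm0 N (Γ.avgVec X N) ≤ 1 := by
  simp only [norm0, xi_mul_norm_coef_avgVec, ← Finset.sum_div]
  exact div_self_le_one _

/-- Hölder's inequality for the norms `‖·‖_0` and `‖·‖_∞`. -/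
theorem norm_inner_le_sum {N : ℕ} (hξ : ∀ k, 0 < Γ.xi N k) (v w : HN A φ N) :
    ‖inner ℂ v w‖ ≤
      ∑ k, Γ.xi N k * ‖Γ.coef N v k‖ * ((Γ.xi N k)⁻¹ * ‖Γ.coef N w k‖) := by
  rw [Γ.inner_eq_sum]
  refine norm_sum_le_of_le _ fun k _ => ?_
  rw [norm_mul, RCLike.norm_conj]
  have := (hξ k).ne'
  exact le_of_eq (by field_simp)

theorem norm_inner_le {N : ℕ} (hξ : ∀ k, 0 < Γ.xi N k) (v w : HN A φ N) {c : ℝ}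
    (h : ∀ k, Γ.coef N v k ≠ 0 → (Γ.xi N k)⁻¹ * ‖Γ.coef N w k‖ ≤ c) :
    ‖inner ℂ v w‖ ≤ Γ.norm0 N v * c := by
  refine (Γ.norm_inner_le_sum hξ v w).trans ?_
  rw [norm0, Finset.sum_mul]
  refine Finset.sum_le_sum fun k _ => ?_
  by_cases h0 : Γ.coef N v k = 0
  · simp [h0]
  · exact mul_le_mul_of_nonneg_left (h k h0) (mul_nonneg (hξ k).le (norm_nonneg _))

theorem norm_inner_avgVec_le {N : ℕ} (hξ : ∀ k, 0 < Γ.xi N k) (X : Set ℂ) (w : HN A φ N) {c : ℝ}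
    (hc : 0 ≤ c) (h : ∀ k, Γ.lam N k ∈ X → (Γ.xi N k)⁻¹ * ‖Γ.coef N w k‖ ≤ c) :
    ‖inner ℂ (Γ.avgVec X N) w‖ ≤ c := by
  refine (Γ.norm_inner_le hξ _ w fun k hk => h k ?_).trans
    (mul_le_of_le_one_left hc (Γ.norm0_avgVec_le_one X N))
  by_contra hX
  exact hk (by rw [coef_avgVec, if_neg hX])

theorem le_supNorm {N : ℕ} {X : Set ℂ} (v : HN A φ N) {k} (hk : Γ.lam N k ∈ X) :
    (Γ.xi N k)⁻¹ * ‖Γ.coef N v k‖ ≤ Γ.supNorm N X v :=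
  le_ciSup (f := fun k : {k // Γ.lam N k ∈ X} => (Γ.xi N k)⁻¹ * ‖Γ.coef N v k‖)
    (Set.finite_range _).bddAbove ⟨k, hk⟩

theorem supNorm_nonneg (N : ℕ) (X : Set ℂ) (v : HN A φ N) : 0 ≤ Γ.supNorm N X v :=
  Real.iSup_nonneg fun k => mul_nonneg (inv_nonneg.2 (Γ.xi_nonneg N k)) (norm_nonneg _)

theorem supNorm_mono {N : ℕ} {X Y : Set ℂ} (h : X ⊆ Y) (v : HN A φ N) :
    Γ.supNorm N X v ≤ Γ.supNorm N Y v :=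
  Real.iSup_le (fun k => Γ.le_supNorm v (h k.2)) (Γ.supNorm_nonneg N Y v)

/-- An ultrafilter on a compact ball converges. -/
theorem tendsto_limUnder_of_norm_le {E : Type*} [NormedAddCommGroup E] [ProperSpace E]
    {f : ℕ → E} {c : ℝ} (h : ∀ᶠ N in (Γ.D : Filter ℕ), ‖f N‖ ≤ c) :
    Tendsto f (Γ.D : Filter ℕ) (𝓝 (limUnder (Γ.D : Filter ℕ) f)) := by
  obtain ⟨x, -, hx⟩ := (isCompact_closedBall (0 : E) c).ultrafilter_le_nhds (Γ.D.map f) (by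
    rw [le_principal_iff, Ultrafilter.mem_coe, Ultrafilter.mem_map]
    filter_upwards [h] with N hN
    simpa using hN)
  exact tendsto_nhds_limUnder ⟨x, hx⟩

/-- Unwinds the iterated limit. Boundedness makes the ultralimits exist, and they are monotone in
`ε`, so the limit as `ε → 0` exists too. -/
theorem bounded_and_eventually_lt_of_normInf_eq_zero {v : Vec A φ} (h : Γ.normInf v = 0) :
    (∃ p : ℕ, ∀ᶠ N in (Γ.D : Filter ℕ), ∀ k, (Γ.xi N k)⁻¹ * ‖Γ.coef N (v N) k‖ < p) ∧
    ∀ δ > 0, ∃ ε > 0, ∀ᶠ N in (Γ.D : Filter ℕ), ∀ k,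
      Γ.lam N k ∈ Metric.cthickening ε (spectrum ℂ A) →
        (Γ.xi N k)⁻¹ * ‖Γ.coef N (v N) k‖ < δ := by
  unfold normInf at h
  split_ifs at h with hb
  · refine ⟨hb, fun δ hδ => ?_⟩
    obtain ⟨p, hp⟩ := hb
    have hlim : ∀ ε, Tendsto (fun N => Γ.supNorm N (Metric.cthickening ε (spectrum ℂ A)) (v N))
        (Γ.D : Filter ℕ) (𝓝 (Γ.normInfEps ε v)) := by
      intro ε
      refine Γ.tendsto_limUnder_of_norm_le (c := p) ?_
      filter_upwards [hp] with N hN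
      rw [Real.norm_of_nonneg (Γ.supNorm_nonneg _ _ _)]
      exact Real.iSup_le (fun k => (hN k).le) p.cast_nonneg
    have hmono : Monotone fun ε => Γ.normInfEps ε v := fun a b hab =>
      le_of_tendsto_of_tendsto' (hlim a) (hlim b) fun N =>
        Γ.supNorm_mono (Metric.cthickening_mono hab _) _
    have hl := (hmono.tendsto_nhdsGT (0 : ℝ)).limUnder_eq
    -- Because `ofReal` truncates, this says only that the limit is at most 0, which suffices.
    rw [ENNReal.ofReal_eq_zero] at h
    have hlt : ∀ᶠ ε in 𝓝[>] (0 : ℝ), Γ.normInfEps ε v < δ :=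
      (hmono.tendsto_nhdsGT (0 : ℝ)).eventually_lt_const (by rw [← hl]; exact h.trans_lt hδ)
    obtain ⟨ε, hε, hε0⟩ := (hlt.and self_mem_nhdsWithin).exists
    refine ⟨ε, hε0, ?_⟩
    filter_upwards [(hlim ε).eventually_lt_const hε] with N hN k hk
    exact (Γ.le_supNorm _ hk).trans_lt hN
  · exact (ENNReal.top_ne_zero h).elim

theorem mem_clsInf_self (v : Vec A φ) : v ∈ Γ.clsInf v := by
  have h0 : ∀ N k, Γ.coef N 0 k = 0 := fun N k => by simp [coef]
  change Γ.normInf (v - v) = 0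
  rw [normInf, if_pos ⟨1, Eventually.of_forall fun N k => by simp [h0]⟩]
  have : (fun ε => Γ.normInfEps ε (v - v)) = fun _ => 0 := by
    ext ε
    refine Tendsto.limUnder_eq (tendsto_const_nhds.congr fun N => ?_)
    simp [supNorm, h0]
  rw [this, tendsto_const_nhds.limUnder_eq, ENNReal.ofReal_zero]

theorem isHmInf_of_bounded {v : Vec A φ} {p : ℕ}
    (h : ∀ᶠ N in (Γ.D : Filter ℕ), ∀ k, (Γ.xi N k)⁻¹ * ‖Γ.coef N (v N) k‖ < p) :
    Γ.IsHmInf v := by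
  rw [IsHmInf, normInf, if_pos ⟨p, h⟩]
  exact ENNReal.ofReal_lt_top

/-- Near `σ(A)` the coordinates of `v` are small. Elsewhere they are merely bounded, but the average
over `Y` gives them total weight at most `μ_N(Z) / μ_N(Y)`, with `Z` the far region, and this tends
to 0. -/
theorem tendsto_inner_avgVec_of_normInf_eq_zero {v : Vec A φ} (hξ : ∀ N k, 0 < Γ.xi N k)
    (hconc : ∀ ε > 0, Tendsto (fun N => Γ.muN N (Metric.cthickening ε (spectrum ℂ A))ᶜ)
      (Γ.D : Filter ℕ) (𝓝 0))
    (hv : Γ.normInf v = 0) {Y : Set ℂ} (hY : 0 < Γ.muNaive Y) :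
    Tendsto (fun N => inner ℂ (Γ.avgVec Y N) (v N)) (Γ.D : Filter ℕ) (𝓝 0) := by
  obtain ⟨⟨p, hp⟩, hsmall⟩ := Γ.bounded_and_eventually_lt_of_normInf_eq_zero hv
  rw [Metric.tendsto_nhds]
  intro δ hδ
  obtain ⟨ε, hε, hev⟩ := hsmall (δ / 2) (by positivity)
  obtain ⟨Z, hZ⟩ : ∃ Z, Z = (Metric.cthickening ε (spectrum ℂ A))ᶜ := ⟨_, rfl⟩
  have hq : Tendsto (fun N => p * (Γ.muN N Z / Γ.muN N Y))
      (Γ.D : Filter ℕ) (𝓝 0) := by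
    rw [hZ]
    simpa using ((hconc ε hε).div (Γ.tendsto_muN Y) hY.ne').const_mul (p : ℝ)
  filter_upwards [hp, hev, hq.eventually_lt_const (show 0 < δ / 2 by positivity)] with N h1 h2 h3
  rw [dist_zero_right]
  refine ((Γ.norm_inner_le_sum (hξ N) _ _).trans (Finset.sum_le_sum (g := fun k =>
    Γ.xi N k * ‖Γ.coef N (Γ.avgVec Y N) k‖ * (δ / 2) +
      p * ((if Γ.lam N k ∈ Z then Γ.xi N k ^ 2 else 0) /
        Γ.muN N Y)) fun k _ => ?_)).trans_lt ?_
  · have hw : 0 ≤ Γ.xi N k * ‖Γ.coef N (Γ.avgVec Y N) k‖ :=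
      mul_nonneg (hξ N k).le (norm_nonneg _)
    have hμ := Setup.muN_nonneg (Γ := Γ) N Y
    by_cases hk : Γ.lam N k ∈ Metric.cthickening ε (spectrum ℂ A)
    · rw [if_neg (show Γ.lam N k ∉ Z by rw [hZ]; exact not_not.2 hk)]
      simpa using mul_le_mul_of_nonneg_left (h2 k hk).le hw
    · rw [if_pos (show Γ.lam N k ∈ Z by rw [hZ]; exact hk)]
      have hw' : Γ.xi N k * ‖Γ.coef N (Γ.avgVec Y N) k‖ ≤ Γ.xi N k ^ 2 / Γ.muN N Y := by
        rw [xi_mul_norm_coef_avgVec]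
        gcongr
        split_ifs
        · exact le_rfl
        · positivity
      have := mul_le_mul hw' (h1 k).le
        (mul_nonneg (inv_nonneg.2 (hξ N k).le) (norm_nonneg _)) (by positivity)
      nlinarith [mul_nonneg hw hδ.le]
  · rw [Finset.sum_add_distrib, ← Finset.sum_mul, ← Finset.mul_sum, ← Finset.sum_div]
    have := mul_le_mul_of_nonneg_right (Γ.norm0_avgVec_le_one Y N) (show 0 ≤ δ / 2 by positivity)
    rw [norm0] at this
    rw [muN] at h3
    linarith

/-- The pairing is the `μ_N`-mean of `h` over `Y`, and the mean of the constant `q` is `q`. -/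
theorem norm_inner_avgVec_F_sub_le {N : ℕ} (hξ : ∀ k, 0 < Γ.xi N k) {Y : Set ℂ}
    (hY : Γ.muN N Y ≠ 0) {h : ℂ → ℂ} {q : ℂ} {ω : ℝ} (hω : 0 ≤ ω)
    (hh : ∀ y ∈ Y, ‖h y - q‖ ≤ ω) : ‖inner ℂ (Γ.avgVec Y N) (Γ.F h N) - q‖ ≤ ω := by
  have hq : inner ℂ (Γ.avgVec Y N) (Γ.F (fun _ => q) N) = q := by
    simp only [Γ.inner_eq_sum, coef_avgVec, coef_F]
    have : ∀ k, (starRingEnd ℂ) (if Γ.lam N k ∈ Y then (Γ.xi N k : ℂ) / (Γ.muN N Y : ℂ) else 0) *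
        (Γ.xi N k * q) = ((if Γ.lam N k ∈ Y then Γ.xi N k ^ 2 else 0 : ℝ) : ℂ) *
          (q / Γ.muN N Y) := by
      intro k
      split_ifs
      · simp only [map_div₀, Complex.conj_ofReal]; push_cast; ring
      · simp
    rw [Finset.sum_congr rfl fun k _ => this k, ← Finset.sum_mul, ← Complex.ofReal_sum]
    change (Γ.muN N Y : ℂ) * _ = q
    have : (Γ.muN N Y : ℂ) ≠ 0 := by exact_mod_cast hY
    field_simp
  have hsub : inner ℂ (Γ.avgVec Y N) (Γ.F h N) - q =
      inner ℂ (Γ.avgVec Y N) (Γ.F (fun z => h z - q) N) := by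
    conv_lhs => rw [← hq]
    rw [← inner_sub_right]
    congr 1
    simp only [F, ← Finset.sum_sub_distrib, ← sub_smul, mul_sub]
  rw [hsub]
  refine Γ.norm_inner_avgVec_le hξ Y _ hω fun k hk => ?_
  rw [coef_F, norm_mul, Complex.norm_real, Real.norm_of_nonneg (hξ k).le,
    inv_mul_cancel_left₀ (hξ k).ne']
  exact hh _ hk

/-- Links the two normalisations: for `c = 1 / μ(X)` the scalar is `μ_N(X) / μ(X)`, which tends to 1
for boxes of positive measure. -/
theorem F_indicator_const {N : ℕ} {X : Set ℂ} (hX : Γ.muN N X ≠ 0) (c : ℂ) :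
    Γ.F (X.indicator fun _ => c) N = (Γ.muN N X * c) • Γ.avgVec X N := by
  have : (Γ.muN N X : ℂ) ≠ 0 := by exact_mod_cast hX
  simp only [F, avgVec, Finset.smul_sum]
  refine Finset.sum_congr rfl fun k _ => ?_
  by_cases hk : Γ.lam N k ∈ X
  · rw [indicator_of_mem hk, if_pos hk, smul_smul]
    congr 1
    field_simp
  · simp [hk]

end Setup

/-- The value at `y` is the `μ`-mean of `K(·, y)` over `X`. -/
theorem NiceSet.norm_BD_sub_le {Γ : Setup A rA φ} (ν : NiceSet Γ) {K : ℂ × ℂ → ℂ}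
    (hK : ContinuousOn K (Γ.S ×ˢ Γ.S)) {X : Set ℂ} (hX : MeasurableSet X) (hXS : X ⊆ Γ.S)
    (hX0 : ν.mu X ≠ 0) (hXt : ν.mu X ≠ ⊤) {y q : ℂ} (hy : y ∈ Γ.S) {ω : ℝ}
    (hω : ∀ x ∈ X, ‖K (x, y) - q‖ ≤ ω) :
    ‖ν.BD K (X.indicator fun _ => ((ν.mu.real X)⁻¹ : ℂ)) y - q‖ ≤ ω := by
  have hpos : 0 < ν.mu.real X := ENNReal.toReal_pos hX0 hXt
  have hKy : ContinuousOn (fun x => K (x, y)) X :=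
    hK.comp (by fun_prop) fun x hx => ⟨hXS hx, hy⟩
  have : IsFiniteMeasure (ν.mu.restrict X) := ⟨by simpa using hXt.lt_top⟩
  have hint : IntegrableOn (fun x => K (x, y) - q) X ν.mu :=
    Integrable.of_bound ((hKy.sub continuousOn_const).aestronglyMeasurable hX) ω
      ((ae_restrict_iff' hX).2 (Eventually.of_forall hω))
  have hint' : IntegrableOn (fun x => K (x, y)) X ν.mu := by
    have := hint.add (integrableOn_const (μ := ν.mu) (s := X) (C := q) hXt)
    simpa [Pi.add_def] using this
  have h1 : ν.BD K (X.indicator fun _ => ((ν.mu.real X)⁻¹ : ℂ)) y =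
      (∫ x in X, K (x, y) ∂ν.mu) * ((ν.mu.real X)⁻¹ : ℂ) := by
    have : (fun x => K (x, y) * X.indicator (fun _ => ((ν.mu.real X)⁻¹ : ℂ)) x) =
        X.indicator fun x => K (x, y) * ((ν.mu.real X)⁻¹ : ℂ) := by
      ext x
      by_cases hx : x ∈ X <;> simp [hx]
    rw [BD, this, setIntegral_indicator hX, inter_eq_right.2 hXS, integral_mul_const]
  have h2 : ∫ x in X, (K (x, y) - q) ∂ν.mu = (∫ x in X, K (x, y) ∂ν.mu) - ν.mu.real X * q := by
    rw [integral_sub hint' (integrableOn_const hXt), setIntegral_const]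
    simp
  have h3 : ν.BD K (X.indicator fun _ => ((ν.mu.real X)⁻¹ : ℂ)) y - q =
      (∫ x in X, (K (x, y) - q) ∂ν.mu) * ((ν.mu.real X)⁻¹ : ℂ) := by
    have : (ν.mu.real X : ℂ) ≠ 0 := by exact_mod_cast hpos.ne'
    rw [h1, h2]
    field_simp
  have h4 := norm_setIntegral_le_of_norm_le_const hXt.lt_top hω
  rw [h3, norm_mul, norm_inv, Complex.norm_real, Real.norm_of_nonneg hpos.le,
    ← div_eq_mul_inv, div_le_iff₀ hpos]
  exact h4

/-- The pairing of averages over `X` and `Y` that `B^u` induces differs from any number `q` by at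
most the oscillation of the kernel around `q` on `X × Y`. -/
theorem NiceSet.norm_lim_sub_le {Γ : Setup A rA φ} (ν : NiceSet Γ) {K : ℂ × ℂ → ℂ}
    (hξ : ∀ N k, 0 < Γ.xi N k)
    (hconc : ∀ ε > 0, Tendsto (fun N => Γ.muN N (Metric.cthickening ε (spectrum ℂ A))ᶜ)
      (Γ.D : Filter ℕ) (𝓝 0))
    (hK : ContinuousOn K (Γ.S ×ˢ Γ.S)) {X Y : Set ℂ} (hX : MeasurableSet X) (hXS : X ⊆ Γ.S)
    (hYS : Y ⊆ Γ.S) (hmu : ν.mu X = ENNReal.ofReal (Γ.muNaive X)) (hX0 : 0 < Γ.muNaive X)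
    (hY0 : 0 < Γ.muNaive Y) (BN : ∀ N, HN A φ N →ₗ[ℂ] HN A φ N)
    (hcls : Γ.clsInf (applyU BN (Γ.F (X.indicator fun _ => ((ν.mu.real X)⁻¹ : ℂ)))) =
      Γ.clsInf (Γ.F (ν.BD K (X.indicator fun _ => ((ν.mu.real X)⁻¹ : ℂ)))))
    {q L : ℂ} {ω : ℝ} (hω0 : 0 ≤ ω) (hω : ∀ x ∈ X, ∀ y ∈ Y, ‖K (x, y) - q‖ ≤ ω)
    (hL : Tendsto (fun N => inner ℂ (Γ.avgVec Y N) (BN N (Γ.avgVec X N))) (Γ.D : Filter ℕ)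
      (𝓝 L)) : ‖L - q‖ ≤ ω := by
  have hreal : ν.mu.real X = Γ.muNaive X := by
    rw [Measure.real, hmu, ENNReal.toReal_ofReal hX0.le]
  set χ : ℂ → ℂ := X.indicator fun _ => ((ν.mu.real X)⁻¹ : ℂ) with hχ
  -- The equality of classes, which comes from (C2)', enters here: the difference of the two
  -- sequences has `‖·‖_∞ = 0`.
  have hmem : applyU BN (Γ.F χ) ∈ Γ.clsInf (Γ.F (ν.BD K χ)) := hcls ▸ Γ.mem_clsInf_self _
  have hE := Γ.tendsto_inner_avgVec_of_normInf_eq_zero hξ hconc hmem hY0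
  have hXC : (Γ.muNaive X : ℂ) ≠ 0 := by exact_mod_cast hX0.ne'
  have hy : Tendsto (fun N => inner ℂ (Γ.avgVec Y N) (BN N (Γ.F χ N))) (Γ.D : Filter ℕ)
      (𝓝 L) := by
    have hc : Tendsto (fun N => (Γ.muN N X : ℂ) * ((ν.mu.real X)⁻¹ : ℂ)) (Γ.D : Filter ℕ)
        (𝓝 1) := by
      have := ((Complex.continuous_ofReal.tendsto _).comp (Γ.tendsto_muN X)).mul_const
        ((ν.mu.real X)⁻¹ : ℂ)
      rwa [hreal, mul_inv_cancel₀ hXC, ← hreal] at this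
    have := hc.mul hL
    rw [one_mul] at this
    refine this.congr' ?_
    filter_upwards [(Γ.tendsto_muN X).eventually_ne hX0.ne'] with N hN
    rw [hχ, Γ.F_indicator_const hN, map_smul, inner_smul_right]
  refine le_of_tendsto ((hy.sub hE).sub_const q).norm ?_ |>.trans_eq' (by simp)
  filter_upwards [(Γ.tendsto_muN Y).eventually_ne hY0.ne'] with N hN
  rw [← inner_sub_right]
  -- Once the null sequence is removed, what remains is the `μ_N`-mean over `Y` of the `μ`-mean over
  -- `X` of `K`.
  have : BN N (Γ.F χ N) - (applyU BN (Γ.F χ) - Γ.F (ν.BD K χ)) N = Γ.F (ν.BD K χ) N := by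
    simp [applyU]
  rw [this]
  refine Γ.norm_inner_avgVec_F_sub_le (hξ N) hN hω0 fun y hyY => ?_
  exact ν.norm_BD_sub_le hK hX hXS (by simpa [hmu] using hX0) (by simp [hmu]) (hYS hyY)
    fun x hx => hω x hx y hyY

end Norms

/-! ### Membership in `H^{m0}`, independence of representatives, and the main result. -/

section MainResult

variable {H : Type*} [NormedAddCommGroup H] [InnerProductSpace ℂ H] [CompleteSpace H]
  {A : H →L[ℂ] H} {rA : ℝ} {φ : H} {Γ : Setup A rA φ} {ν : NiceSet Γ}

/-- Averages over sets that shrink to a spectral point define an element of `H^{m0}`. -/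
theorem SquareFamily.isHm0_avgVec (Q : SquareFamily ν) {z : ℂ} (hz : z ∈ spectrum ℂ A)
    (X : ℕ → Set ℂ)
    (hX : ∀ ρ > 0, ∀ᶠ N in (Γ.D : Filter ℕ), ∀ w ∈ X N, dist z w < ρ) :
    Q.IsHm0 fun N => Γ.avgVec (X N) N := by
  refine ⟨fun n Y _ hd => ?_, 2, Eventually.of_forall fun N => ?_⟩
  · obtain ⟨d, hd, hdist⟩ := hd
    refine tendsto_const_nhds.congr' ?_
    filter_upwards [hX d hd] with N hN
    refine (Finset.sum_eq_zero fun k _ => ?_).symm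
    split_ifs with hk
    · have : Γ.lam N k ∉ X N := fun hmem => (hN _ hmem).not_ge (hdist z hz _ hk)
      simp [Γ.coef_avgVec, this]
    · rfl
  · exact (Γ.norm0_avgVec_le_one _ _).trans_lt (by norm_num)

/-- A `‖·‖_0`-null change of the first argument is paired with coordinates bounded by `p + p'`. A
`‖·‖_∞`-null change of the second is tested only on `X N`, which eventually lies in any
neighbourhood of `z ∈ σ(A)`, where the change is uniformly small. -/
theorem hasPairing_of_tendsto (hξ : ∀ N k, 0 < Γ.xi N k) {z : ℂ} (hz : z ∈ spectrum ℂ A)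
    (X : ℕ → Set ℂ)
    (hX : ∀ ρ > 0, ∀ᶠ N in (Γ.D : Filter ℕ), ∀ w ∈ X N, dist z w < ρ)
    {v : Vec A φ} {p : ℕ}
    (hv : ∀ᶠ N in (Γ.D : Filter ℕ), ∀ k, (Γ.xi N k)⁻¹ * ‖Γ.coef N (v N) k‖ < p) {q : ℂ}
    (hq : Tendsto (fun N => inner ℂ (Γ.avgVec (X N) N) (v N)) (Γ.D : Filter ℕ) (𝓝 q)) :
    Γ.HasPairing (Γ.cls0 fun N => Γ.avgVec (X N) N) (Γ.clsInf v) q := by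
  intro f hf w hw
  obtain ⟨⟨p', hp'⟩, hsmall⟩ := Γ.bounded_and_eventually_lt_of_normInf_eq_zero hw
  have h1 : Tendsto (fun N => inner ℂ (f N - Γ.avgVec (X N) N) (w N)) (Γ.D : Filter ℕ) (𝓝 0) := by
    have hf' : Tendsto (fun N => Γ.norm0 N (f N - Γ.avgVec (X N) N)) (Γ.D : Filter ℕ) (𝓝 0) := hf
    refine squeeze_zero_norm' ?_ (by simpa using hf'.mul_const ((p : ℝ) + p'))
    filter_upwards [hv, hp'] with N h1 h2
    refine Γ.norm_inner_le (hξ N) _ _ fun k _ => ?_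
    have e : Γ.coef N (w N) k = Γ.coef N (v N) k + Γ.coef N ((w - v) N) k := by
      rw [← Γ.coef_add]; simp
    rw [e]
    refine (mul_le_mul_of_nonneg_left (norm_add_le _ _) (inv_nonneg.2 (hξ N k).le)).trans ?_
    rw [mul_add]
    exact add_le_add (h1 k).le (h2 k).le
  have h2 : Tendsto (fun N => inner ℂ (Γ.avgVec (X N) N) ((w - v) N)) (Γ.D : Filter ℕ)
      (𝓝 0) := by
    rw [Metric.tendsto_nhds]
    intro δ hδ
    obtain ⟨ε, hε, hev⟩ := hsmall (δ / 2) (by positivity)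
    filter_upwards [hev, hX ε hε] with N h1 h2
    rw [dist_zero_right]
    refine (Γ.norm_inner_avgVec_le (hξ N) (X N) _ (by positivity) fun k hk =>
      (h1 k ?_).le).trans_lt (half_lt_self hδ)
    exact Metric.mem_cthickening_of_dist_le _ z _ _ hz (by rw [dist_comm]; exact (h2 _ hk).le)
  have := (h1.add h2).add hq
  rw [zero_add, zero_add] at this
  refine this.congr fun N => ?_
  simp only [Pi.sub_apply, inner_sub_left, inner_sub_right]
  ring

end MainResult

end RiggedApprox
end

theorem proposition5p4 {H : Type*} [NormedAddCommGroup H] [InnerProductSpace ℂ H]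
    [CompleteSpace H] [TopologicalSpace.SeparableSpace H]
    (A : H →L[ℂ] H) (rA : ℝ) (hrA : 0 < rA)
    (hA : ContinuousLinearMap.adjoint A * A = (rA : ℂ) • (1 : H →L[ℂ] H))
    (hA' : A * ContinuousLinearMap.adjoint A = (rA : ℂ) • (1 : H →L[ℂ] H))
    (φ : H) (hφ : ‖φ‖ = 1) (hcyc : RiggedApprox.IsCyclic A φ)
    (Γ : RiggedApprox.Setup A rA φ) (ν : RiggedApprox.NiceSet Γ)
    (Q : RiggedApprox.SquareFamily ν)
    (B : H →ₗ[ℂ] H) (K : ℂ × ℂ → ℂ) (hK : ContinuousOn K (Γ.S ×ˢ Γ.S)) (hBK : ν.IsKernel B K)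
    (α β : spectrum ℂ A) (g : RiggedApprox.Grid Γ (α : ℂ) (β : ℂ))
    (BN : ∀ N, RiggedApprox.HN A φ N →ₗ[ℂ] RiggedApprox.HN A φ N)
    (h1 : RiggedApprox.CondOne BN Γ) (h2 : RiggedApprox.CondTwo ν BN g K)
    (h3 : RiggedApprox.CondThree BN g)
    (n : ℕ → ℕ) (ε : ℕ → ℝ) (Uα Uβ : Set ℕ)
    (hα : g.IsGood ν (Γ.dirac α) n ε Uα) (hβ : g.IsGood ν (Γ.dirac β) n ε Uβ)
    (hstar : RiggedApprox.CondStar BN g n (Uα ∩ Uβ)) :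
    Q.IsHm0 (g.uVec ν (Γ.dirac β) n) ∧
    Γ.IsHmInf (RiggedApprox.applyU BN (g.uVec ν (Γ.dirac α) n)) ∧
    Γ.HasPairing (Γ.cls0 (g.uVec ν (Γ.dirac β) n))
      (Γ.clsInf (RiggedApprox.applyU BN (g.uVec ν (Γ.dirac α) n))) (K (α, β)) ∧
    ∀ Binf : Set (RiggedApprox.Vec A φ) → Set (RiggedApprox.Vec A φ),
      (∀ v, Binf (Γ.clsInf v) = Γ.clsInf (RiggedApprox.applyU BN v)) →
      Γ.HasPairing (Γ.cls0 (g.uVec ν (Γ.dirac β) n))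
        (Binf (Γ.clsInf (g.uVec ν (Γ.dirac α) n))) (K (α, β)) := by
  classical
  have hξ := Γ.xi_pos hrA hA hA'
  have hconc : ∀ ε > 0, Tendsto (fun N => Γ.muN N (Metric.cthickening ε (spectrum ℂ A))ᶜ)
      (Γ.D : Filter ℕ) (𝓝 0) := fun ε hε => Γ.tendsto_muN_compl_cthickening hrA hA hA' hφ hε
  have hαS := Γ.spectrum_subset α.2
  have hβS := Γ.spectrum_subset β.2
  choose i hi i' hi' hαb using fun p => g.exists_box (n := p) hαS fun k hk =>
    ⟨(g.avoid p k hk).1, (g.avoid p k hk).2.1⟩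
  choose j hj j' hj' hβb using fun p => g.exists_box (n := p) hβS fun k hk =>
    ⟨(g.avoid p k hk).2.2.1, (g.avoid p k hk).2.2.2⟩
  have hαpos := fun p => g.muNaive_box_pos hrA hA hA' hφ hcyc α.2 (hi p) (hi' p) (hαb p)
  have hβpos := fun p => g.muNaive_box_pos hrA hA hA' hφ hcyc β.2 (hj p) (hj' p) (hβb p)
  have huα : g.uVec ν (Γ.dirac α) n =
      fun N => Γ.avgVec (g.box (n N) (i (n N)) (i' (n N))) N :=
    funext fun N => g.uVec_dirac ν n (hi _) (hi' _) (hαb _) (hαpos _)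
  have huβ : g.uVec ν (Γ.dirac β) n =
      fun N => Γ.avgVec (g.box (n N) (j (n N)) (j' (n N))) N :=
    funext fun N => g.uVec_dirac ν n (hj _) (hj' _) (hβb _) (hβpos _)
  have hn : ∀ m : ℕ, ∀ᶠ N in (Γ.D : Filter ℕ), m < n N := fun m => by
    filter_upwards [hα.tends (m + 1) m.succ_pos] with N hN
    exact m.lt_succ_self.trans hN.1
  obtain ⟨P, hP⟩ := h3
  -- Every eigenvalue lies in `S`, so the sup norm over `S` in (C3)' bounds all coordinates,
  -- uniformly in the level `p` and in `N`.
  have hbd : ∀ p N k,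
      (Γ.xi N k)⁻¹ * ‖Γ.coef N (BN N (Γ.avgVec (g.box p (i p) (i' p)) N)) k‖ < P := fun p N k =>
    (Γ.le_supNorm _ (Γ.lam_mem_S hrA.le hA N k)).trans_lt (hP p _ (hi p) _ (hi' p) N)
  have hsmall : ∀ ρ > 0, ∃ m : ℕ, ∀ p, m < p → (4 * Γ.M / (p + 1) : ℝ) < ρ ∧ (1 / p : ℝ) < ρ := by
    intro ρ hρ
    obtain ⟨m, hm⟩ := exists_nat_gt (max (4 * Γ.M / ρ : ℝ) (1 / ρ))
    refine ⟨m, fun p hp => ?_⟩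
    have hmp : (m : ℝ) < p := by exact_mod_cast hp
    have hm1 := (le_max_left _ _).trans_lt hm
    have hm2 := (le_max_right _ _).trans_lt hm
    rw [div_lt_iff₀ hρ] at hm1 hm2
    have hp0 : (0 : ℝ) < p := (Nat.cast_nonneg m).trans_lt hmp
    constructor
    · rw [div_lt_iff₀ (by positivity)]
      nlinarith
    · rw [div_lt_iff₀ hp0]
      nlinarith
  have hclose : ∀ ρ > 0, ∀ᶠ N in (Γ.D : Filter ℕ),
      ∀ w ∈ g.box (n N) (j (n N)) (j' (n N)), dist (β : ℂ) w < ρ := by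
    intro ρ hρ
    obtain ⟨m, hm⟩ := hsmall ρ hρ
    filter_upwards [hn m] with N hN w hw
    exact (g.dist_lt_of_mem_box (hj _) (hj' _) (hβb _) hw).trans (hm _ hN).1
  -- The diagonal limit: the level `n(N)` moves with `N`, whereas (C2)' only speaks of fixed levels.
  have hlim : Tendsto (fun N => inner ℂ (Γ.avgVec (g.box (n N) (j (n N)) (j' (n N))) N)
      (BN N (Γ.avgVec (g.box (n N) (i (n N)) (i' (n N))) N))) (Γ.D : Filter ℕ)
      (𝓝 (K (α, β))) := by
    rw [Metric.tendsto_nhds]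
    intro δ hδ
    obtain ⟨ρ, hρ, hKρ⟩ := Metric.continuousOn_iff.1 hK (α, β) ⟨hαS, hβS⟩ (δ / 2) (by positivity)
    obtain ⟨m, hm⟩ := hsmall (min ρ (δ / 2)) (lt_min hρ (by positivity))
    filter_upwards [hn m, hα.mem, hβ.mem] with N hN hNα hNβ
    obtain ⟨hmρ, hmδ⟩ := hm _ hN
    -- At level `p = n(N)` the value at the index `N` itself is within `1/p < δ/2` of the ultralimit
    -- at that level; `hbound` below accounts for the other `δ/2`.
    have hst := hstar N ⟨hNα, hNβ⟩ (n N) rfl (by omega)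
    rw [g.boxAt_eq (hj _) (hj' _) (hβb _), g.boxAt_eq (hi _) (hi' _) (hαb _)] at hst
    have hL := Γ.tendsto_limUnder_of_norm_le (c := P)
      (f := fun N' => inner ℂ (Γ.avgVec (g.box (n N) (j (n N)) (j' (n N))) N')
        (BN N' (Γ.avgVec (g.box (n N) (i (n N)) (i' (n N))) N')))
      (Eventually.of_forall fun N' => Γ.norm_inner_avgVec_le (hξ N') _ _ P.cast_nonneg
        fun k _ => (hbd _ N' k).le)
    have hX := g.isOpen_box (hi (n N)) (hi' (n N))
    have hbound := ν.norm_lim_sub_le hξ hconc hK hX.measurableSet (fun _ hx => hx.1)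
      (fun _ hx => hx.1) (g.mu_box ν (hi _) (hi' _)) (hαpos (n N)) (hβpos (n N)) BN
      (h2 (n N) _ (hi _) _ (hi' _) (by simpa [g.mu_box ν (hi _) (hi' _)] using hαpos (n N)))
      (q := K (α, β)) (ω := δ / 2) (by positivity) (fun x hx y hy => by
        rw [← dist_eq_norm]
        refine (hKρ (x, y) ⟨hx.1, hy.1⟩ (max_lt ?_ ?_)).le
        · exact (g.dist_lt_of_mem_box (hi _) (hi' _) hx (hαb _)).trans
            (hmρ.trans_le (min_le_left _ _))
        · exact (g.dist_lt_of_mem_box (hj _) (hj' _) hy (hβb _)).trans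
            (hmρ.trans_le (min_le_left _ _))) hL
    rw [dist_eq_norm]
    refine (norm_sub_le_norm_sub_add_norm_sub _ _ _).trans_lt
      ((add_lt_add_of_lt_of_le (hst.trans (hmδ.trans_le (min_le_right _ _))) hbound).trans_eq ?_)
    ring
  have hbdα : ∀ᶠ N in (Γ.D : Filter ℕ), ∀ k, (Γ.xi N k)⁻¹ *
      ‖Γ.coef N (RiggedApprox.applyU BN (g.uVec ν (Γ.dirac α) n) N) k‖ < P := by
    rw [huα]
    exact Eventually.of_forall fun N k => hbd _ N k
  have hpair : Γ.HasPairing (Γ.cls0 (g.uVec ν (Γ.dirac β) n))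
      (Γ.clsInf (RiggedApprox.applyU BN (g.uVec ν (Γ.dirac α) n))) (K (α, β)) := by
    rw [huβ]
    refine RiggedApprox.hasPairing_of_tendsto hξ β.2 _ hclose hbdα ?_
    rw [huα]
    exact hlim
  refine ⟨?_, Γ.isHmInf_of_bounded hbdα, hpair, fun Binf hB => by rw [hB]; exact hpair⟩
  rw [huβ]
  exact Q.isHm0_avgVec β.2 _ hclose
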